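/- Let $\Omega$ be a complete separable metric space with its Borel $\sigma$-field, $\mathcal X$ the space of bounded Borel functions $\Omega\to\mathbb R$, and let $E_\mu,E_\upsilon:\mathcal X\to\mathbb R$ be sublinear operators (monotone, constant preserving, subadditive, positively homogeneous). Put $E_{\bar\upsilon}[X]=-E_\upsilon[-X]$, $\rho=E_\mu\vee E_\upsilon$ and $c(A)=\rho(I_A)$; a Borel set $A$ is polar if $c(A)=0$, and a property holds quasi-surely (q.s.) if it holds outside a polar set. Let $L^1_c$ be the set of all $f\in\mathcal X$ that are limits of functions in $C_b(\Omega)$ for the seminorm $\rho(|\cdot|)$. An operator $E$ is continuous from above on $L^1_c$ if $E[f_n]\downarrow 0$ whenever $f_n\in L^1_c$ and $f_n\downarrow0$ q.s. For $\alpha\in(0,1)$ let $\mathcal T=\{f\in L^1_c:0\le f\le1\text{ q.s.}\}$ and $\mathcal T_\alpha=\{f\in\mathcal T: E_\mu[f]\le\alpha\}$; a test $f_\alpha\in\mathcal T_\alpha$ is optimal if $E_{\bar\upsilon}[f_\alpha]=\sup_{f\in\mathcal T_\alpha}E_{\bar\upsilon}[f]$. **Theorem.** Suppose that $E_\mu$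 and $E_\upsilon$ are both continuous from above on $L^1_c$ and that an optimal test exists. Then there is a linear functional on $L^1_c$, dominated by $E_\upsilon$, whose supremum over $\mathcal T_\alpha$ equals $\sup_{f\in\mathcal T_\alpha}E_{\bar\upsilon}[f]$, and every such functional is integration $f\mapsto\int f\,dQ_\alpha$ against a Borel probability measure $Q_\alpha$. For each such $Q_\alpha$, with $\gamma_\alpha:=\sup_{f\in\mathcal T_\alpha}\int f\,dQ_\alpha$, every optimal test $f_\alpha$ satisfies $\int f_\alpha\,dQ_\alpha=\gamma_\alpha$, and the following holds. 1. Suppose that $\int X\,dQ_\alpha<\gamma_\alpha$ for all $X\in\mathcal T_\alpha$ with $E_\mu[X]<\alpha$, and put $\mathcal Y_\alpha=\{Y\in\mathcal T:\int Y\,dQ_\alpha\ge\gamma_\alpha\}$. Then there is a linear functional on $L^1_c$, dominated by $E_\mu$, whose infimum over $\mathcal Y_\alpha$ equals $\inf_{Y\in\mathcal Y_\alpha}E_\mu[Y]$, and every such functional is integration against a Borel probability measure $P_\alpha$. For each such $P_\alpha$ there is a real $\kappa\ge0$ such that every optimal test $f_\alpha$ has the form $$f_\alpha=I_{\{H>\kappa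 G\}}+B\,I_{\{H=\kappa G\}}\quad K\text{-a.s.}$$ for some measurable $B:\Omega\to[0,1]$, where $K=\tfrac12(P_\alpha+Q_\alpha)$, $H=dQ_\alpha/dK$ and $G=dP_\alpha/dK$. 2. Suppose that some $X\in\mathcal T_\alpha$ has $E_\mu[X]<\alpha$ and $\int X\,dQ_\alpha=\gamma_\alpha$. Then for every Borel probability measure $P$ and every optimal test $f_\alpha$ there is a measurable $B:\Omega\to[0,1]$ with $$f_\alpha=I_{\{H>0\}}+B\,I_{\{H=0\}}\quad K\text{-a.s. on }\{0\le f_\alpha\le1\},$$ where $K=\tfrac12(P+Q_\alpha)$ and $H=dQ_\alpha/dK$; the complement of $\{0\le f_\alpha\le 1\}$ is polar, hence may be ignored if $P$ does not charge polar sets. -/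

import Mathlib

open MeasureTheory Filter Topology
open scoped BoundedContinuousFunction ENNReal

/-- `X` is a bounded measurable real function on `Ω`, i.e. an element of the space `𝒳`. -/
def BddMeas {Ω : Type*} [MeasurableSpace Ω] (X : Ω → ℝ) : Prop :=
  Measurable X ∧ ∃ C : ℝ, ∀ ω, |X ω| ≤ C

/-- `E` is a sublinear operator on the bounded measurable functions. The operator is written as a
total function of `X : Ω → ℝ`, but only its values at bounded measurable functions are ever used. -/
structure IsSublinearOperator {Ω : Type*} [MeasurableSpace Ω] (E : (Ω → ℝ) → ℝ) : Prop where
  mono : ∀ X Y, BddMeas X → BddMeas Y → (∀ ω, X ω ≤ Y ω) → E X ≤ E Y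
  const : ∀ c : ℝ, E (fun _ => c) = c
  subadd : ∀ X Y, BddMeas X → BddMeas Y → E (fun ω => X ω + Y ω) ≤ E X + E Y
  homog : ∀ (l : ℝ) X, 0 ≤ l → BddMeas X → E (fun ω => l * X ω) = l * E X

/-- The conjugate operator `X ↦ -E[-X]`. -/
def conjOp {Ω : Type*} (E : (Ω → ℝ) → ℝ) (X : Ω → ℝ) : ℝ := -E (fun ω => -X ω)

/-- `ρ = Eμ ∨ Eυ`. -/
noncomputable def rhoOp {Ω : Type*} (Eμ Eυ : (Ω → ℝ) → ℝ) (X : Ω → ℝ) : ℝ := max (Eμ X) (Eυ X)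

/-- The set function `c(A) = ρ(I_A)`. -/
noncomputable def capOf {Ω : Type*} (Eμ Eυ : (Ω → ℝ) → ℝ) (A : Set Ω) : ℝ :=
  rhoOp Eμ Eυ (A.indicator fun _ => 1)

/-- `p` holds `c`-quasi-surely: it holds outside a (Borel) polar set. -/
def QuasiSurely {Ω : Type*} [MeasurableSpace Ω] (Eμ Eυ : (Ω → ℝ) → ℝ) (p : Ω → Prop) : Prop :=
  ∃ A : Set Ω, MeasurableSet A ∧ capOf Eμ Eυ A = 0 ∧ ∀ ω, ω ∉ A → p ω

/-- The functions that represent elements of `L¹_c`: those bounded measurable functions which are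
limits of bounded continuous functions for the (semi)norm `ρ(|·|)`. -/
def L1c {Ω : Type*} [TopologicalSpace Ω] [MeasurableSpace Ω] (Eμ Eυ : (Ω → ℝ) → ℝ) :
    Set (Ω → ℝ) :=
  {f | BddMeas f ∧ ∀ ε : ℝ, 0 < ε → ∃ g : Ω →ᵇ ℝ, rhoOp Eμ Eυ (fun ω => |f ω - g ω|) < ε}

/-- `E` is continuous from above on `L¹_c`: `f n ↓ 0` quasi-surely implies `E (f n) → 0`
(that `E (f n)` decreases is automatic for a sublinear operator). -/
def ContinuousFromAboveOnL1c {Ω : Type*} [TopologicalSpace Ω] [MeasurableSpace Ω]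
    (Eμ Eυ E : (Ω → ℝ) → ℝ) : Prop :=
  ∀ f : ℕ → Ω → ℝ, (∀ n, f n ∈ L1c Eμ Eυ) →
    QuasiSurely Eμ Eυ
      (fun ω => Antitone (fun n => f n ω) ∧ Tendsto (fun n => f n ω) atTop (𝓝 0)) →
    Tendsto (fun n => E (f n)) atTop (𝓝 0)

/-- The randomized tests `f ∈ L¹_c`, `0 ≤ f ≤ 1` quasi-surely. -/
def L1cTests {Ω : Type*} [TopologicalSpace Ω] [MeasurableSpace Ω] (Eμ Eυ : (Ω → ℝ) → ℝ) :
    Set (Ω → ℝ) :=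
  {f | f ∈ L1c Eμ Eυ ∧ QuasiSurely Eμ Eυ (fun ω => 0 ≤ f ω ∧ f ω ≤ 1)}

/-- The tests in `L¹_c` of level `α`. -/
def levelTests {Ω : Type*} [TopologicalSpace Ω] [MeasurableSpace Ω] (Eμ Eυ : (Ω → ℝ) → ℝ)
    (α : ℝ) : Set (Ω → ℝ) :=
  {f | f ∈ L1cTests Eμ Eυ ∧ Eμ f ≤ α}

/-- `f` is an optimal test: it has level `α` and maximizes the conjugate operator of `Eυ` among
the tests of level `α`. -/
def IsOptimalTest {Ω : Type*} [TopologicalSpace Ω] [MeasurableSpace Ω] (Eμ Eυ : (Ω → ℝ) → ℝ)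
    (α : ℝ) (f : Ω → ℝ) : Prop :=
  f ∈ levelTests Eμ Eυ α ∧ conjOp Eυ f = sSup (conjOp Eυ '' levelTests Eμ Eυ α)

/-- `L` is a linear functional on `L¹_c` dominated by `E` (only the values of `L` on `L¹_c`
matter). -/
structure IsDominatedLinear {Ω : Type*} [TopologicalSpace Ω] [MeasurableSpace Ω]
    (Eμ Eυ E L : (Ω → ℝ) → ℝ) : Prop where
  add : ∀ f ∈ L1c Eμ Eυ, ∀ g ∈ L1c Eμ Eυ, L (fun ω => f ω + g ω) = L f + L g
  smul : ∀ (a : ℝ), ∀ f ∈ L1c Eμ Eυ, L (fun ω => a * f ω) = a * L f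
  le : ∀ f ∈ L1c Eμ Eυ, L f ≤ E f

/-- `L` is an admissible choice of `E_{Q_α}`: a linear functional on `L¹_c` dominated by `Eυ` for
which the supremum over the tests of level `α` is that of the conjugate operator of `Eυ`. -/
def IsQSelection {Ω : Type*} [TopologicalSpace Ω] [MeasurableSpace Ω] (Eμ Eυ : (Ω → ℝ) → ℝ)
    (α : ℝ) (L : (Ω → ℝ) → ℝ) : Prop :=
  IsDominatedLinear Eμ Eυ Eυ L ∧
    sSup (L '' levelTests Eμ Eυ α) = sSup (conjOp Eυ '' levelTests Eμ Eυ α)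

/-- The largest `Q`-power `γ_α` of a test of level `α`. -/
noncomputable def maxPower {Ω : Type*} [TopologicalSpace Ω] [MeasurableSpace Ω]
    (Eμ Eυ : (Ω → ℝ) → ℝ) (α : ℝ) (Q : Measure Ω) : ℝ :=
  sSup ((fun f : Ω → ℝ => ∫ ω, f ω ∂Q) '' levelTests Eμ Eυ α)

/-- The set `𝒴_α` of tests in `L¹_c` whose `Q`-power is at least `γ_α`. -/
def powerfulTests {Ω : Type*} [TopologicalSpace Ω] [MeasurableSpace Ω] (Eμ Eυ : (Ω → ℝ) → ℝ)
    (α : ℝ) (Q : Measure Ω) : Set (Ω → ℝ) :=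
  {Y | Y ∈ L1cTests Eμ Eυ ∧ maxPower Eμ Eυ α Q ≤ ∫ ω, Y ω ∂Q}

/-- `M` is an admissible choice of `E_{P_α}` (given `Q`): a linear functional on `L¹_c` dominated
by `Eμ` whose infimum over `𝒴_α` is that of `Eμ`. -/
def IsPSelection {Ω : Type*} [TopologicalSpace Ω] [MeasurableSpace Ω] (Eμ Eυ : (Ω → ℝ) → ℝ)
    (α : ℝ) (Q : Measure Ω) (M : (Ω → ℝ) → ℝ) : Prop :=
  IsDominatedLinear Eμ Eυ Eμ M ∧
    sInf (M '' powerfulTests Eμ Eυ α Q) = sInf (Eμ '' powerfulTests Eμ Eυ α Q)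

/-- The functional `L` is integration against `P` on `L¹_c`. -/
def IsIntegralOnL1c {Ω : Type*} [TopologicalSpace Ω] [MeasurableSpace Ω]
    (Eμ Eυ L : (Ω → ℝ) → ℝ) (P : Measure Ω) : Prop :=
  ∀ f ∈ L1c Eμ Eυ, L f = ∫ ω, f ω ∂P

/-- The measure `(P + Q) / 2`. -/
noncomputable def halfSum {Ω : Type*} [MeasurableSpace Ω] (P Q : Measure Ω) : Measure Ω :=
  (2 : ℝ≥0∞)⁻¹ • (P + Q)

/-- The density of `R` with respect to `K`, as a real function. -/
noncomputable def densityOf {Ω : Type*} [MeasurableSpace Ω] (R K : Measure Ω) (ω : Ω) : ℝ :=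
  (R.rnDeriv K ω).toReal

/-- The Neyman-Pearson form `I_{H > κ G} + B I_{H = κ G}`, where `H = dQ/dK`, `G = dP/dK`
and `K = (P + Q) / 2`. -/
noncomputable def npForm {Ω : Type*} [MeasurableSpace Ω] (P Q : Measure Ω) (κ : ℝ) (B : Ω → ℝ) :
    Ω → ℝ :=
  fun ω =>
    {x | κ * densityOf P (halfSum P Q) x < densityOf Q (halfSum P Q) x}.indicator (fun _ => 1) ω +
    {x | densityOf Q (halfSum P Q) x = κ * densityOf P (halfSum P Q) x}.indicator B ω

/-! The nonlinear testing problem is reduced to one between two measures, found by Hahn–Banach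
rather than by compactness. If a sublinear `E` is at least `β` on a convex set, some linear
functional dominated by `E` is too (`exists_isDominatedLinear_ge`). Applied to negatives of
level-`α` tests this yields the functional for `Q`; applied to the powerful tests, the one for `P`.
Continuity from above makes every dominated functional a Daniell functional, hence an integral
(`IsDaniell.exists_measure`).

In the first case every test of `Q`-power at least `γ` has `P`-size at least `α`. The convex set of
pairs (size, power) thus avoids an open quadrant, and separation gives one multiplier `κ` for all
optimal tests (`exists_multiplier`). An optimal test has `P`-size at most `α` and power `γ`, so it
minimizes `κ P - Q` over tests. By density of continuous functions it does at least as well as the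
indicator of `{H > κ G}`, and must agree with it off `{H = κ G}` (`exists_npForm_of_le`).

In the second case, mixing the test of smaller level with the constant `1` would raise its power
unless `γ = 1`. Optimal tests are then `1` almost surely under `Q`, which is the form with
multiplier `0`. -/

/-- `L` is a Daniell functional on the vector lattice `V` of real functions containing `1`. -/
structure IsDaniell {Ω : Type*} (V : Submodule ℝ (Ω → ℝ)) (L : (Ω → ℝ) → ℝ) : Prop where
  one_mem : (1 : Ω → ℝ) ∈ V
  posPart_mem : ∀ f ∈ V, f ⊔ 0 ∈ V
  add : ∀ f ∈ V, ∀ g ∈ V, L (f + g) = L f + L g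
  smul : ∀ (a : ℝ), ∀ f ∈ V, L (a • f) = a * L f
  nonneg : ∀ f ∈ V, 0 ≤ f → 0 ≤ L f
  tendsto : ∀ f : ℕ → Ω → ℝ, (∀ n, f n ∈ V) → Antitone f →
    (∀ x, Tendsto (fun n => f n x) atTop (𝓝 0)) → Tendsto (fun n => L (f n)) atTop (𝓝 0)

/-! ### Daniell–Stone representation of positive functionals -/

namespace IsDaniell

variable {Ω : Type*} {V : Submodule ℝ (Ω → ℝ)} {L : (Ω → ℝ) → ℝ}

theorem inf_mem (hL : IsDaniell V L) {f g : Ω → ℝ} (hf : f ∈ V) (hg : g ∈ V) : f ⊓ g ∈ V := by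
  have h := V.sub_mem hf (hL.posPart_mem _ (V.sub_mem hf hg))
  convert h using 1
  ext x
  simp only [Pi.inf_apply, Pi.sub_apply, Pi.sup_apply, Pi.zero_apply]
  rcases le_total (f x) (g x) with h | h
  · rw [min_eq_left h, max_eq_right (by linarith)]; ring
  · rw [min_eq_right h, max_eq_left (by linarith)]; ring

theorem const_mem (hL : IsDaniell V L) (c : ℝ) : (fun _ => c : Ω → ℝ) ∈ V := by
  convert V.smul_mem c hL.one_mem using 1
  ext x
  simp

theorem sub (hL : IsDaniell V L) {f g : Ω → ℝ} (hf : f ∈ V) (hg : g ∈ V) :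
    L (f - g) = L f - L g := by
  have h1 := hL.add f hf ((-1 : ℝ) • g) (V.smul_mem _ hg)
  rw [hL.smul _ g hg] at h1
  rw [show f - g = f + (-1 : ℝ) • g by ext x; simp [sub_eq_add_neg], h1]
  ring

theorem mono (hL : IsDaniell V L) {f g : Ω → ℝ} (hf : f ∈ V) (hg : g ∈ V) (h : f ≤ g) :
    L f ≤ L g := by
  have := hL.nonneg (g - f) (V.sub_mem hg hf) (sub_nonneg.2 h)
  rw [hL.sub hg hf] at this
  linarith

theorem map_sum (hL : IsDaniell V L) {ι : Type*} (s : Finset ι) {f : ι → Ω → ℝ}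
    (hf : ∀ i, f i ∈ V) : L (∑ i ∈ s, f i) = ∑ i ∈ s, L (f i) := by
  classical
  induction s using Finset.induction_on with
  | empty => simpa using hL.smul 0 0 V.zero_mem
  | insert i s hi ih =>
    rw [Finset.sum_insert hi, Finset.sum_insert hi,
      hL.add _ (hf i) _ (V.sum_mem fun j _ => hf j), ih]

/-- An increasing sequence of nonnegative functions of `V` whose supremum is at least `1` on `A`. -/
structure Covers (V : Submodule ℝ (Ω → ℝ)) (A : Set Ω) (h : ℕ → Ω → ℝ) : Prop where
  mem : ∀ n, h n ∈ V
  mono : Monotone h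
  nonneg : ∀ n, 0 ≤ h n
  cover : ∀ x ∈ A, ∀ r < 1, ∃ n, r < h n x

/-- The outer content of a set defined by a Daniell functional. -/
noncomputable def outer (V : Submodule ℝ (Ω → ℝ)) (L : (Ω → ℝ) → ℝ) (A : Set Ω) : ℝ≥0∞ :=
  ⨅ (h : ℕ → Ω → ℝ) (_ : Covers V A h), ⨆ n, ENNReal.ofReal (L (h n))

theorem outer_le {A : Set Ω} {h : ℕ → Ω → ℝ} (hh : Covers V A h) :
    outer V L A ≤ ⨆ n, ENNReal.ofReal (L (h n)) :=
  iInf₂_le h hh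

theorem outer_mono {A B : Set Ω} (hAB : A ⊆ B) : outer V L A ≤ outer V L B :=
  le_iInf₂ fun _ hh => outer_le ⟨hh.mem, hh.mono, hh.nonneg, fun x hx => hh.cover x (hAB hx)⟩

theorem outer_empty (hL : IsDaniell V L) : outer V L ∅ = 0 := by
  have h0 : L 0 = 0 := by simpa using hL.smul 0 0 V.zero_mem
  have : Covers V ∅ (fun _ => 0) :=
    ⟨fun _ => V.zero_mem, monotone_const, fun _ => le_rfl, fun x hx => hx.elim⟩
  simpa [h0] using outer_le (L := L) this

theorem exists_covers {A : Set Ω} {c : ℝ≥0∞} (hc : outer V L A < c) :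
    ∃ h, Covers V A h ∧ ∀ n, ENNReal.ofReal (L (h n)) ≤ c := by
  obtain ⟨h, hc⟩ := iInf_lt_iff.1 hc
  obtain ⟨hh, hc⟩ := iInf_lt_iff.1 hc
  exact ⟨h, hh, fun n => (le_iSup (fun n => ENNReal.ofReal (L (h n))) n).trans hc.le⟩

/-- A diagonal argument: choose near-optimal covers with summable errors and let stage `n` be the
sum of the first `n` covers at index `n`. Only finite sums occur, so no limit has to lie in `V`. -/
theorem outer_iUnion_le (hL : IsDaniell V L) (A : ℕ → Set Ω) :
    outer V L (⋃ i, A i) ≤ ∑' i, outer V L (A i) := by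
  refine ENNReal.le_of_forall_pos_le_add fun ε hε hfin => ?_
  obtain ⟨δ, hδ, hδs⟩ := ENNReal.exists_pos_sum_of_countable
    (ENNReal.coe_pos.2 hε).ne' ℕ
  have hlt : ∀ i, outer V L (A i) < outer V L (A i) + δ i := fun i =>
    ENNReal.lt_add_right ((ENNReal.le_tsum i).trans_lt hfin).ne
      (ENNReal.coe_pos.2 (hδ i)).ne'
  choose h hcov hle using fun i => exists_covers (hlt i)
  have hnn : ∀ i n, 0 ≤ L (h i n) := fun i n =>
    hL.nonneg _ ((hcov i).mem n) ((hcov i).nonneg n)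
  have hC : Covers V (⋃ i, A i) (fun n => ∑ i ∈ Finset.range n, h i n) := by
    refine ⟨fun n => V.sum_mem fun i _ => (hcov i).mem n, fun m n hmn => ?_,
      fun n => Finset.sum_nonneg fun i _ => (hcov i).nonneg n, fun x hx r hr => ?_⟩
    · exact (Finset.sum_le_sum fun i _ => (hcov i).mono hmn).trans
        (Finset.sum_le_sum_of_subset_of_nonneg (Finset.range_subset_range.2 hmn)
          fun i _ _ => (hcov i).nonneg n)
    · obtain ⟨i, hi⟩ := Set.mem_iUnion.1 hx
      obtain ⟨n, hn⟩ := (hcov i).cover x hi r hr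
      -- From stage `i + 1` on, the diagonal sum includes the `i`-th cover.
      refine ⟨max n (i + 1), hn.trans_le (((hcov i).mono (le_max_left n (i + 1)) x).trans ?_)⟩
      rw [Finset.sum_apply]
      exact Finset.single_le_sum (f := fun j => h j (max n (i + 1)) x)
        (fun j _ => (hcov j).nonneg _ x)
        (Finset.mem_range.2 (lt_of_lt_of_le (Nat.lt_succ_self i) (le_max_right _ _)))
  refine (outer_le hC).trans (iSup_le fun n => ?_)
  rw [hL.map_sum _ fun i => (hcov i).mem n, ENNReal.ofReal_sum_of_nonneg fun i _ => hnn i n]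
  calc ∑ i ∈ Finset.range n, ENNReal.ofReal (L (h i n))
      ≤ ∑ i ∈ Finset.range n, (outer V L (A i) + δ i) := Finset.sum_le_sum fun i _ => hle i n
    _ ≤ ∑' i, (outer V L (A i) + δ i) := ENNReal.sum_le_tsum _
    _ = (∑' i, outer V L (A i)) + ∑' i, (δ i : ℝ≥0∞) := ENNReal.tsum_add
    _ ≤ _ := by gcongr

/-- The outer measure defined by a Daniell functional. -/
noncomputable def outerMeasure (hL : IsDaniell V L) : OuterMeasure Ω where
  measureOf := outer V L
  empty := hL.outer_empty
  mono := outer_mono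
  iUnion_nat A _ := hL.outer_iUnion_le A

theorem outerMeasure_apply (hL : IsDaniell V L) (A : Set Ω) :
    hL.outerMeasure A = outer V L A := rfl

/-- Daniell continuity for increasing sequences. -/
theorem le_of_forall_lt_exists (hL : IsDaniell V L) {g : Ω → ℝ} (hg : g ∈ V) {h : ℕ → Ω → ℝ}
    (hh : ∀ n, h n ∈ V) (hm : Monotone h) (hgh : ∀ x, ∀ r < g x, ∃ n, r < h n x) {c : ℝ}
    (hc : ∀ n, L (h n) ≤ c) : L g ≤ c := by
  -- The positive parts of `g - h n` decrease to zero even if the limit of `h` is not in `V`.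
  have hV : ∀ n, (g - h n) ⊔ 0 ∈ V := fun n => hL.posPart_mem _ (V.sub_mem hg (hh n))
  have ht : Tendsto (fun n => L ((g - h n) ⊔ 0)) atTop (𝓝 0) := by
    refine hL.tendsto _ hV (fun m n hmn => sup_le_sup_right (sub_le_sub_left (hm hmn) g) 0)
      fun x => ?_
    rw [tendsto_order]
    refine ⟨fun a ha => Eventually.of_forall fun n => lt_of_lt_of_le ha (le_max_right _ _),
      fun a ha => ?_⟩
    obtain ⟨n, hn⟩ := hgh x (g x - a) (by linarith)
    filter_upwards [eventually_ge_atTop n] with m hmn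
    have := hm hmn x
    simp only [Pi.sup_apply, Pi.sub_apply, Pi.zero_apply]
    exact max_lt (by linarith) ha
  have hle : ∀ n, L g - c ≤ L ((g - h n) ⊔ 0) := fun n => by
    have h1 := hL.mono (V.sub_mem hg (hh n)) (hV n) le_sup_left
    rw [hL.sub hg (hh n)] at h1
    linarith [hc n]
  linarith [ge_of_tendsto' ht hle]

theorem ofReal_le_outer (hL : IsDaniell V L) {g : Ω → ℝ} (hg : g ∈ V) {A : Set Ω}
    (h1 : ∀ x, g x ≤ 1) (h0 : ∀ x, x ∉ A → g x ≤ 0) : ENNReal.ofReal (L g) ≤ outer V L A := by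
  refine le_iInf₂ fun h hh => ?_
  by_cases hfin : (⨆ n, ENNReal.ofReal (L (h n))) = ∞
  · rw [hfin]; exact le_top
  rw [ENNReal.ofReal_le_iff_le_toReal hfin]
  refine hL.le_of_forall_lt_exists (h := h) hg hh.mem hh.mono (fun x r hr => ?_) fun n => ?_
  · by_cases hx : x ∈ A
    · exact hh.cover x hx r (hr.trans_le (h1 x))
    · exact ⟨0, (hr.trans_le (h0 x hx)).trans_le (hh.nonneg 0 x)⟩
  · rw [← ENNReal.ofReal_le_iff_le_toReal hfin]
    exact le_iSup (fun n => ENNReal.ofReal (L (h n))) n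

theorem outer_univ (hL : IsDaniell V L) : outer V L Set.univ = ENNReal.ofReal (L 1) := by
  refine le_antisymm ?_ (hL.ofReal_le_outer hL.one_mem (fun _ => le_rfl) (by simp))
  have : Covers V Set.univ (fun _ => (1 : Ω → ℝ)) :=
    ⟨fun _ => hL.one_mem, monotone_const, fun _ => zero_le_one, fun x _ r hr => ⟨0, hr⟩⟩
  simpa using outer_le (L := L) this

/-- The functions `g k` increase to the indicator of `U` and vanish off `U`. They split a cover of
`A` as `h n = (h n ⊓ g k) + (h n - g k) ⊔ 0`: the first summands, taken diagonally, cover `A ∩ U`,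
and for fixed `k` the second cover `A \ U`. -/
theorem isCaratheodory (hL : IsDaniell V L) {f : Ω → ℝ} (hf : f ∈ V) (t : ℝ) :
    hL.outerMeasure.IsCaratheodory {x | t < f x} := by
  refine (OuterMeasure.isCaratheodory_iff_le _).2 fun A => ?_
  simp only [outerMeasure_apply]
  set U := {x | t < f x} with hU
  let g : ℕ → Ω → ℝ := fun k => ((k : ℝ) • ((f - fun _ => t) ⊔ 0)) ⊓ 1
  have hgV : ∀ k, g k ∈ V := fun k => hL.inf_mem
    (V.smul_mem _ (hL.posPart_mem _ (V.sub_mem hf (hL.const_mem t)))) hL.one_mem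
  have hg0 : ∀ k, 0 ≤ g k := fun k x => by
    simp only [g, Pi.inf_apply, Pi.smul_apply, Pi.sup_apply, Pi.sub_apply, Pi.zero_apply,
      Pi.one_apply, smul_eq_mul]
    positivity
  have hgm : Monotone g := fun k l hkl x => by
    simp only [g, Pi.inf_apply, Pi.smul_apply, Pi.sup_apply, Pi.sub_apply, Pi.zero_apply,
      Pi.one_apply, smul_eq_mul]
    gcongr
  have hgU : ∀ x ∈ U, ∃ k, g k x = 1 := fun x hx => by
    have hx : 0 < f x - t := sub_pos.2 hx
    obtain ⟨k, hk⟩ := exists_nat_gt (1 / (f x - t))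
    refine ⟨k, min_eq_right ?_⟩
    simp only [Pi.smul_apply, Pi.sup_apply, Pi.sub_apply, Pi.zero_apply,
      Pi.one_apply, smul_eq_mul, max_eq_left hx.le]
    exact ((div_lt_iff₀ hx).1 hk).le
  have hgU' : ∀ x, x ∉ U → ∀ k, g k x = 0 := fun x hx k => by
    have hx : f x - t ≤ 0 := by simpa [hU] using hx
    simp [g, max_eq_right hx]
  refine le_iInf₂ fun h hh => ?_
  have hmin : Covers V (A ∩ U) (fun n => h n ⊓ g n) := by
    refine ⟨fun n => hL.inf_mem (hh.mem n) (hgV n),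
      fun m n hmn => inf_le_inf (hh.mono hmn) (hgm hmn),
      fun n => le_inf (hh.nonneg n) (hg0 n), fun x hx r hr => ?_⟩
    obtain ⟨n, hn⟩ := hh.cover x hx.1 r hr
    obtain ⟨k, hk⟩ := hgU x hx.2
    refine ⟨max n k, lt_min (hn.trans_le (hh.mono (le_max_left n k) x)) ?_⟩
    exact hr.trans_le (hk ▸ hgm (le_max_right n k) x)
  have hdiff : ∀ k, Covers V (A \ U) (fun n => (h n - g k) ⊔ 0) := fun k => by
    refine ⟨fun n => hL.posPart_mem _ (V.sub_mem (hh.mem n) (hgV k)),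
      fun m n hmn => sup_le_sup_right (sub_le_sub_right (hh.mono hmn) _) _,
      fun n => le_sup_right, fun x hx r hr => ?_⟩
    obtain ⟨n, hn⟩ := hh.cover x hx.1 r hr
    refine ⟨n, lt_of_lt_of_le ?_ (le_max_left _ _)⟩
    simpa [hgU' x hx.2 k] using hn
  have hsplit : ∀ k n, ENNReal.ofReal (L (h n ⊓ g k)) + ENNReal.ofReal (L ((h n - g k) ⊔ 0)) =
      ENNReal.ofReal (L (h n)) := fun k n => by
    rw [← ENNReal.ofReal_add (hL.nonneg _ (hL.inf_mem (hh.mem n) (hgV k))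
        (le_inf (hh.nonneg n) (hg0 k))) (hL.nonneg _ ((hdiff k).mem n) ((hdiff k).nonneg n)),
      ← hL.add _ (hL.inf_mem (hh.mem n) (hgV k)) _ ((hdiff k).mem n)]
    congr 2
    ext x
    simp only [Pi.add_apply, Pi.inf_apply, Pi.sup_apply, Pi.sub_apply, Pi.zero_apply]
    rcases le_total (h n x) (g k x) with h' | h'
    · rw [min_eq_left h', max_eq_right (by linarith)]; ring
    · rw [min_eq_right h', max_eq_left (by linarith)]; ring
  calc outer V L (A ∩ U) + outer V L (A \ U)
      ≤ (⨆ k, ENNReal.ofReal (L (h k ⊓ g k))) + outer V L (A \ U) := by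
        gcongr; exact outer_le hmin
    _ ≤ _ := by
        rw [ENNReal.iSup_add]
        refine iSup_le fun k => ?_
        calc ENNReal.ofReal (L (h k ⊓ g k)) + outer V L (A \ U)
            ≤ ENNReal.ofReal (L (h k ⊓ g k)) +
                ⨆ n, ENNReal.ofReal (L ((h n - g k) ⊔ 0)) := by
              gcongr; exact outer_le (hdiff k)
          _ ≤ _ := by
              rw [ENNReal.add_iSup]
              refine iSup_le fun n => ?_
              -- With `g k` fixed, both summands grow with the index of `h`, so they can be
              -- recombined at `max k n`.
              refine le_trans ?_ (le_iSup (fun n => ENNReal.ofReal (L (h n))) (max k n))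
              rw [← hsplit k (max k n)]
              gcongr
              · exact hL.mono (hL.inf_mem (hh.mem _) (hgV k)) (hL.inf_mem (hh.mem _) (hgV k))
                  (inf_le_inf_right _ (hh.mono (le_max_left k n)))
              · exact hL.mono ((hdiff k).mem _) ((hdiff k).mem _)
                  ((hdiff k).mono (le_max_right k n))

/-- The Daniell–Stone theorem for bounded functions. -/
theorem exists_measure [mΩ : MeasurableSpace Ω] (hL : IsDaniell V L)
    (hV : ∀ f ∈ V, Measurable f) (hb : ∀ f ∈ V, ∃ C : ℝ, ∀ x, |f x| ≤ C)
    (hgen : mΩ ≤ MeasurableSpace.generateFrom {s | ∃ f ∈ V, ∃ t, s = {x | t < f x}}) :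
    ∃ μ : Measure Ω, IsFiniteMeasure μ ∧ ∀ f ∈ V, L f = ∫ x, f x ∂μ := by
  have hle : mΩ ≤ hL.outerMeasure.caratheodory := hgen.trans <| by
    refine MeasurableSpace.generateFrom_le ?_
    rintro s ⟨f, hf, t, rfl⟩
    exact hL.isCaratheodory hf t
  set μ := hL.outerMeasure.toMeasure hle with hμ
  have hμa : ∀ s, MeasurableSet s → μ s = outer V L s := fun s hs => toMeasure_apply _ _ hs
  have hfin : IsFiniteMeasure μ := ⟨by
    rw [hμa _ MeasurableSet.univ, hL.outer_univ]; exact ENNReal.ofReal_lt_top⟩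
  have hreal : μ.real Set.univ = L 1 := by
    rw [measureReal_def, hμa _ MeasurableSet.univ, hL.outer_univ,
      ENNReal.toReal_ofReal (hL.nonneg _ hL.one_mem zero_le_one)]
  have hint : ∀ f ∈ V, Integrable f μ := fun f hf => by
    obtain ⟨C, hC⟩ := hb f hf
    exact Integrable.of_bound (hV f hf).aestronglyMeasurable C (Eventually.of_forall hC)
  refine ⟨μ, hfin, ?_⟩
  -- The slice of `f` of height `δ` above `t` is at most `δ` times the indicator of `{t < f}`, which
  -- is at most the slice above `t - δ`. Passing through the indicator costs a shift by `δ`.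
  have layer : ∀ f ∈ V, ∀ δ > 0, ∀ t,
      L (((f - fun _ => t) ⊔ 0) ⊓ fun _ => δ) ≤
        ∫ x, (((f - fun _ => t - δ) ⊔ 0) ⊓ fun _ => δ) x ∂μ := fun f hf δ hδ t => by
    have hg : ((f - fun _ => t) ⊔ 0) ⊓ (fun _ => δ) ∈ V := hL.inf_mem
      (hL.posPart_mem _ (V.sub_mem hf (hL.const_mem t))) (hL.const_mem δ)
    have hg' : ((f - fun _ => t - δ) ⊔ 0) ⊓ (fun _ => δ) ∈ V := hL.inf_mem
      (hL.posPart_mem _ (V.sub_mem hf (hL.const_mem _))) (hL.const_mem δ)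
    have hms : MeasurableSet {x | t < f x} := measurableSet_lt measurable_const (hV f hf)
    have h1 : δ⁻¹ * L (((f - fun _ => t) ⊔ 0) ⊓ fun _ => δ) ≤ μ.real {x | t < f x} := by
      rw [← hL.smul _ _ hg, measureReal_def, ← ENNReal.ofReal_le_iff_le_toReal (measure_ne_top _ _),
        hμa _ hms]
      refine hL.ofReal_le_outer (V.smul_mem _ hg) (fun x => ?_) fun x hx => ?_
      · simp only [Pi.smul_apply, Pi.inf_apply, smul_eq_mul]
        rw [inv_mul_le_iff₀ hδ, mul_one]
        exact min_le_right _ _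
      · have hx : f x - t ≤ 0 := by simpa using hx
        simp [max_eq_right hx, hδ.le]
    rw [inv_mul_le_iff₀ hδ] at h1
    refine h1.trans ?_
    rw [mul_comm, ← smul_eq_mul, ← integral_indicator_const δ hms]
    refine integral_mono ((integrable_const δ).indicator hms) (hint _ hg') fun x => ?_
    by_cases hx : t < f x
    · rw [Set.indicator_of_mem (by exact hx)]
      refine le_min (le_trans ?_ (le_max_left _ _)) le_rfl
      change δ ≤ f x - (t - δ)
      linarith [show t < f x from hx]
    · rw [Set.indicator_of_notMem (by exact hx)]
      exact le_min (le_max_right _ _) hδ.le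
  have step : ∀ (a δ : ℝ), 0 < δ → ∀ n : ℕ,
      min a ((n + 1 : ℕ) * δ) = min a (n * δ) + min (max (a - n * δ) 0) δ := fun a δ hδ n => by
    push_cast
    rcases le_total a (n * δ) with h | h
    · rw [min_eq_left h, min_eq_left (by linarith), max_eq_right (by linarith), min_eq_left hδ.le,
        add_zero]
    · rw [min_eq_right h, max_eq_left (by linarith), ← min_add_add_left]
      congr 1 <;> ring
  -- Adding up the slices telescopes by `step`; the shift of each slice turns `f` into `f + δ` on
  -- the right.
  have trunc : ∀ f ∈ V, 0 ≤ f → ∀ δ > 0, ∀ n : ℕ,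
      L (f ⊓ fun _ => n * δ) ≤ ∫ x, min (f x + δ) (n * δ) ∂μ := fun f hf h0 δ hδ n => by
    have hmem : ∀ g ∈ V, ∀ c : ℝ, (fun x => min (g x) c) ∈ V := fun g hg c =>
      hL.inf_mem hg (hL.const_mem c)
    have hfδ : (fun x => f x + δ) ∈ V := V.add_mem hf (hL.const_mem δ)
    induction n with
    | zero =>
      have e1 : (f ⊓ fun _ => ((0 : ℕ) : ℝ) * δ) = (0 : ℝ) • f := by
        ext x; simpa using h0 x
      rw [e1, hL.smul 0 f hf, zero_mul]
      exact integral_nonneg fun x => by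
        simpa using add_nonneg (h0 x) hδ.le
    | succ n ih =>
      have e1 : (f ⊓ fun _ => ((n + 1 : ℕ) : ℝ) * δ) =
          (f ⊓ fun _ => n * δ) + (((f - fun _ => n * δ) ⊔ 0) ⊓ fun _ => δ) := by
        ext x
        exact step (f x) δ hδ n
      have hg : ((f - fun _ => n * δ - δ) ⊔ 0) ⊓ (fun _ => δ) ∈ V := hL.inf_mem
        (hL.posPart_mem _ (V.sub_mem hf (hL.const_mem _))) (hL.const_mem δ)
      rw [e1, hL.add _ (hL.inf_mem hf (hL.const_mem _)) _ (hL.inf_mem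
        (hL.posPart_mem _ (V.sub_mem hf (hL.const_mem _))) (hL.const_mem δ))]
      have e2 : ∀ x, min (f x + δ) ((n + 1 : ℕ) * δ) = min (f x + δ) (n * δ) +
          (((f - fun _ => n * δ - δ) ⊔ 0) ⊓ fun _ => δ) x := fun x => by
        rw [step _ δ hδ n]
        simp only [Pi.inf_apply, Pi.sup_apply, Pi.sub_apply, Pi.zero_apply]
        congr 3
        ring
      simp_rw [e2]
      rw [integral_add (hint _ (hmem _ hfδ _)) (hint _ hg)]
      exact add_le_add ih (layer f hf δ hδ _)
  have hpos : ∀ f ∈ V, 0 ≤ f → L f ≤ ∫ x, f x ∂μ := fun f hf h0 => by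
    have key : ∀ δ > 0, L f ≤ (∫ x, f x ∂μ) + δ * L 1 := fun δ hδ => by
      obtain ⟨C, hC⟩ := hb f hf
      obtain ⟨n, hn⟩ := exists_nat_gt (C / δ)
      have hn : C < n * δ := (div_lt_iff₀ hδ).1 hn
      have e1 : (f ⊓ fun _ => n * δ) = f := inf_eq_left.2 fun x =>
        ((le_abs_self _).trans (hC x)).trans hn.le
      have h1 := trunc f hf h0 δ hδ n
      rw [e1] at h1
      refine h1.trans ?_
      have h2 : (∫ x, (f x + δ) ∂μ) = (∫ x, f x ∂μ) + δ * L 1 := by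
        rw [integral_add (hint f hf) (integrable_const δ), integral_const, hreal, smul_eq_mul,
          mul_comm]
      rw [← h2]
      have hfδ : (fun x => f x + δ) ∈ V := V.add_mem hf (hL.const_mem δ)
      exact integral_mono (hint _ (hL.inf_mem hfδ (hL.const_mem _))) (hint _ hfδ)
        fun x => min_le_left _ _
    have hlim : Tendsto (fun δ : ℝ => (∫ x, f x ∂μ) + δ * L 1) (𝓝[>] 0) (𝓝 (∫ x, f x ∂μ)) := by
      have : Continuous fun δ : ℝ => (∫ x, f x ∂μ) + δ * L 1 := by fun_prop
      simpa using (this.tendsto 0).mono_left nhdsWithin_le_nhds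
    exact ge_of_tendsto hlim (eventually_mem_nhdsWithin.mono fun δ hδ => key δ hδ)
  -- Adding a constant removes the sign condition; the converse inequality then comes from `-f`.
  have hle' : ∀ f ∈ V, L f ≤ ∫ x, f x ∂μ := fun f hf => by
    obtain ⟨C, hC⟩ := hb f hf
    have h1 := hpos (f + C • 1) (V.add_mem hf (V.smul_mem C hL.one_mem)) fun x => by
      have := (abs_le.1 (hC x)).1
      simp only [Pi.zero_apply, Pi.add_apply, Pi.smul_apply, Pi.one_apply, smul_eq_mul, mul_one]
      linarith
    rw [hL.add _ hf _ (V.smul_mem C hL.one_mem), hL.smul _ _ hL.one_mem] at h1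
    simp only [Pi.add_apply, Pi.smul_apply, Pi.one_apply, smul_eq_mul, mul_one] at h1
    rw [integral_add (hint f hf) (integrable_const C), integral_const, hreal, smul_eq_mul] at h1
    linarith
  intro f hf
  refine le_antisymm (hle' f hf) ?_
  have h1 := hle' ((-1 : ℝ) • f) (V.smul_mem _ hf)
  rw [hL.smul _ f hf] at h1
  simp only [Pi.smul_apply, smul_eq_mul, neg_one_mul, integral_neg] at h1
  linarith

end IsDaniell

/-! ### Sublinear operators and quasi-sure order -/

section Sublinear

variable {Ω : Type*} [MeasurableSpace Ω] {X Y : Ω → ℝ}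

theorem BddMeas.add (hX : BddMeas X) (hY : BddMeas Y) : BddMeas (fun ω => X ω + Y ω) := by
  obtain ⟨hX, C, hC⟩ := hX
  obtain ⟨hY, D, hD⟩ := hY
  exact ⟨hX.add hY, C + D, fun ω => (abs_add_le _ _).trans (add_le_add (hC ω) (hD ω))⟩

theorem BddMeas.const_mul (a : ℝ) (hX : BddMeas X) : BddMeas (fun ω => a * X ω) := by
  obtain ⟨hX, C, hC⟩ := hX
  exact ⟨hX.const_mul a, |a| * C, fun ω => by rw [abs_mul]; gcongr; exact hC ω⟩

theorem BddMeas.neg (hX : BddMeas X) : BddMeas (fun ω => -X ω) := by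
  simpa using hX.const_mul (-1)

theorem BddMeas.sub (hX : BddMeas X) (hY : BddMeas Y) : BddMeas (fun ω => X ω - Y ω) := by
  simpa [sub_eq_add_neg] using hX.add hY.neg

theorem BddMeas.abs (hX : BddMeas X) : BddMeas (fun ω => |X ω|) := by
  obtain ⟨hX, C, hC⟩ := hX
  exact ⟨hX.abs, C, fun ω => by simpa using hC ω⟩

theorem BddMeas.const (c : ℝ) : BddMeas (fun _ : Ω => c) :=
  ⟨measurable_const, |c|, fun _ => le_rfl⟩

theorem BddMeas.indicator_one {A : Set Ω} (hA : MeasurableSet A) :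
    BddMeas (A.indicator fun _ => (1 : ℝ)) :=
  ⟨measurable_const.indicator hA, 1, fun ω => by by_cases h : ω ∈ A <;> simp [h]⟩

theorem BddMeas.integrable {f : Ω → ℝ} (hf : BddMeas f) (μ : Measure Ω) [IsFiniteMeasure μ] :
    Integrable f μ :=
  Integrable.of_bound hf.1.aestronglyMeasurable hf.2.choose
    (Eventually.of_forall hf.2.choose_spec)

variable {E Eμ Eυ : (Ω → ℝ) → ℝ}

theorem IsSublinearOperator.rhoOp (hμ : IsSublinearOperator Eμ) (hυ : IsSublinearOperator Eυ) :
    IsSublinearOperator (rhoOp Eμ Eυ) where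
  mono X Y hX hY h := max_le_max (hμ.mono X Y hX hY h) (hυ.mono X Y hX hY h)
  const c := by simp [_root_.rhoOp, hμ.const, hυ.const]
  subadd X Y hX hY := max_le
    ((hμ.subadd X Y hX hY).trans (add_le_add (le_max_left _ _) (le_max_left _ _)))
    ((hυ.subadd X Y hX hY).trans (add_le_add (le_max_right _ _) (le_max_right _ _)))
  homog l X hl hX := by
    simp only [_root_.rhoOp, hμ.homog l X hl hX, hυ.homog l X hl hX, mul_max_of_nonneg _ _ hl]

theorem IsSublinearOperator.neg_le (hE : IsSublinearOperator E) (hX : BddMeas X) :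
    -E (fun ω => -X ω) ≤ E X := by
  have h := hE.subadd _ _ hX hX.neg
  simp only [add_neg_cancel, hE.const] at h
  linarith

theorem IsSublinearOperator.indicator_nonneg (hE : IsSublinearOperator E) {A : Set Ω}
    (hA : MeasurableSet A) : 0 ≤ E (A.indicator fun _ => 1) := by
  rw [← hE.const 0]
  exact hE.mono _ _ (.const 0) (.indicator_one hA)
    fun ω => Set.indicator_nonneg (fun _ _ => zero_le_one) ω

theorem capOf_union_eq_zero (hμ : IsSublinearOperator Eμ) (hυ : IsSublinearOperator Eυ)
    {A B : Set Ω} (hA : MeasurableSet A) (hB : MeasurableSet B) (h0A : capOf Eμ Eυ A = 0)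
    (h0B : capOf Eμ Eυ B = 0) : capOf Eμ Eυ (A ∪ B) = 0 := by
  have hρ := hμ.rhoOp hυ
  refine le_antisymm ?_ (hρ.indicator_nonneg (hA.union hB))
  have h1 := hρ.mono _ _ (.indicator_one (hA.union hB))
    ((BddMeas.indicator_one hA).add (.indicator_one hB)) fun ω => by
      by_cases h1 : ω ∈ A <;> by_cases h2 : ω ∈ B <;> simp [h1, h2]
  have h2 := hρ.subadd _ _ (.indicator_one hA) (.indicator_one hB)
  unfold capOf at *
  linarith

theorem QuasiSurely.and (hμ : IsSublinearOperator Eμ) (hυ : IsSublinearOperator Eυ)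
    {p q : Ω → Prop} (hp : QuasiSurely Eμ Eυ p) (hq : QuasiSurely Eμ Eυ q) :
    QuasiSurely Eμ Eυ fun ω => p ω ∧ q ω := by
  obtain ⟨A, hA, h0A, hp⟩ := hp
  obtain ⟨B, hB, h0B, hq⟩ := hq
  exact ⟨A ∪ B, hA.union hB, capOf_union_eq_zero hμ hυ hA hB h0A h0B,
    fun ω hω => ⟨hp ω fun h => hω (.inl h), hq ω fun h => hω (.inr h)⟩⟩

theorem QuasiSurely.mono {p q : Ω → Prop} (hp : QuasiSurely Eμ Eυ p) (h : ∀ ω, p ω → q ω) :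
    QuasiSurely Eμ Eυ q := by
  obtain ⟨A, hA, h0A, hp⟩ := hp
  exact ⟨A, hA, h0A, fun ω hω => h ω (hp ω hω)⟩

theorem QuasiSurely.of_forall (hμ : IsSublinearOperator Eμ) (hυ : IsSublinearOperator Eυ)
    {p : Ω → Prop} (h : ∀ ω, p ω) : QuasiSurely Eμ Eυ p :=
  ⟨∅, .empty, by simp [capOf, rhoOp, hμ.const, hυ.const], fun ω _ => h ω⟩

/-- Sublinear operators dominated by `ρ` are monotone for the quasi-sure order. -/
theorem IsSublinearOperator.mono_quasiSurely (hE : IsSublinearOperator E)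
    (hEρ : ∀ X, E X ≤ _root_.rhoOp Eμ Eυ X) (hX : BddMeas X) (hY : BddMeas Y)
    (h : QuasiSurely Eμ Eυ fun ω => X ω ≤ Y ω) : E X ≤ E Y := by
  obtain ⟨A, hA, h0, h⟩ := h
  obtain ⟨C, hC⟩ := hX.2
  obtain ⟨D, hD⟩ := hY.2
  have hI : BddMeas (A.indicator fun _ => (1 : ℝ)) := .indicator_one hA
  -- On the polar set `X - Y ≤ C + D`; the absolute value makes the factor admissible for positive
  -- homogeneity.
  have hCD : 0 ≤ |C + D| := abs_nonneg _
  have h1 := hE.mono _ _ hX (hY.add (hI.const_mul |C + D|)) fun ω => by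
    by_cases hω : ω ∈ A
    · simp only [Set.indicator_of_mem hω, mul_one]
      have := le_abs_self (C + D)
      linarith [(abs_le.1 (hC ω)).2, (abs_le.1 (hD ω)).1]
    · simpa [hω] using h ω hω
  have h2 := hE.subadd _ _ hY (hI.const_mul |C + D|)
  rw [hE.homog _ _ hCD hI] at h2
  have h3 : E (A.indicator fun _ => 1) ≤ 0 := (hEρ _).trans h0.le
  nlinarith

theorem IsSublinearOperator.apply_combo_le (hE : IsSublinearOperator E) {f g : Ω → ℝ}
    (hf : BddMeas f) (hg : BddMeas g) {a b : ℝ} (ha : 0 ≤ a) (hb : 0 ≤ b) :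
    E (a • f + b • g) ≤ a * E f + b * E g := by
  rw [← hE.homog a f ha hf, ← hE.homog b g hb hg]
  exact hE.subadd _ _ (hf.const_mul a) (hg.const_mul b)

end Sublinear

/-- Representing measures do not charge polar sets. -/
theorem IsIntegralOnL1c.ae_of_quasiSurely {Ω : Type*} [TopologicalSpace Ω]
    [MeasurableSpace Ω] {E Eμ Eυ : (Ω → ℝ) → ℝ} {L : (Ω → ℝ) → ℝ}
    (hEρ : ∀ X, E X ≤ rhoOp Eμ Eυ X) (hL : IsDominatedLinear Eμ Eυ E L) {P : Measure Ω}
    [IsProbabilityMeasure P] (hP : IsIntegralOnL1c Eμ Eυ L P) {p : Ω → Prop}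
    (hp : QuasiSurely Eμ Eυ p) : ∀ᵐ ω ∂P, p ω := by
  obtain ⟨A, hA, h0, hp⟩ := hp
  -- The indicator of a polar set has distance zero from the function `0`, so domination applies to
  -- it.
  have hmem : (A.indicator fun _ => (1 : ℝ)) ∈ L1c Eμ Eυ := by
    refine ⟨.indicator_one hA, fun ε hε => ⟨0, ?_⟩⟩
    have : (fun ω => |A.indicator (fun _ => (1 : ℝ)) ω - (0 : Ω →ᵇ ℝ) ω|) =
        A.indicator fun _ => 1 := by
      ext ω
      by_cases h : ω ∈ A <;> simp [h]
    rw [this]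
    exact h0.trans_lt hε
  have h1 := hP _ hmem
  rw [integral_indicator_const _ hA, smul_eq_mul, mul_one] at h1
  have h2 : P.real A ≤ 0 := h1 ▸ (hL.le _ hmem).trans ((hEρ _).trans h0.le)
  have h3 : P A = 0 := (measureReal_eq_zero_iff).1 (le_antisymm h2 measureReal_nonneg)
  rw [ae_iff]
  exact measure_mono_null (fun ω hω => by_contra fun h => hω (hp ω h)) h3

/-! ### The vector lattice `L1c` -/

section L1c

variable {Ω : Type*} [TopologicalSpace Ω] [MeasurableSpace Ω] [OpensMeasurableSpace Ω]
  {E Eμ Eυ : (Ω → ℝ) → ℝ}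

theorem BddMeas.of_boundedContinuous (g : Ω →ᵇ ℝ) : BddMeas g :=
  ⟨g.continuous.measurable, ‖g‖, g.norm_coe_le_norm⟩

theorem boundedContinuous_mem_L1c (hμ : IsSublinearOperator Eμ) (hυ : IsSublinearOperator Eυ)
    (g : Ω →ᵇ ℝ) : (g : Ω → ℝ) ∈ L1c Eμ Eυ :=
  ⟨.of_boundedContinuous g, fun ε hε => ⟨g, by simpa [(hμ.rhoOp hυ).const] using hε⟩⟩

/-- The space `L¹_c` as a linear subspace of the real functions. -/
def L1cSubmodule (hμ : IsSublinearOperator Eμ) (hυ : IsSublinearOperator Eυ) :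
    Submodule ℝ (Ω → ℝ) where
  carrier := L1c Eμ Eυ
  zero_mem' := boundedContinuous_mem_L1c hμ hυ 0
  add_mem' := by
    rintro f g ⟨hf, hf'⟩ ⟨hg, hg'⟩
    refine ⟨hf.add hg, fun ε hε => ?_⟩
    have hρ := hμ.rhoOp hυ
    obtain ⟨u, hu⟩ := hf' (ε / 2) (half_pos hε)
    obtain ⟨v, hv⟩ := hg' (ε / 2) (half_pos hε)
    have hfu := (hf.sub (.of_boundedContinuous u)).abs
    have hgv := (hg.sub (.of_boundedContinuous v)).abs
    refine ⟨u + v, ?_⟩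
    have h1 := hρ.mono _ _ ((hf.add hg).sub (.of_boundedContinuous (u + v))).abs (hfu.add hgv)
      fun ω => by
        have := abs_add_le (f ω - u ω) (g ω - v ω)
        rwa [show f ω - u ω + (g ω - v ω) = f ω + g ω - (u + v) ω by
          simp only [BoundedContinuousFunction.coe_add, Pi.add_apply]; ring] at this
    have h2 := hρ.subadd _ _ hfu hgv
    change rhoOp Eμ Eυ (fun ω => |f ω + g ω - (u + v) ω|) < ε
    linarith
  smul_mem' := by
    rintro a f ⟨hf, hf'⟩
    refine ⟨hf.const_mul a, fun ε hε => ?_⟩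
    have hρ := hμ.rhoOp hυ
    -- The added `1` covers `a = 0`.
    have ha : 0 < |a| + 1 := by positivity
    obtain ⟨u, hu⟩ := hf' (ε / (|a| + 1)) (by positivity)
    have hfu := (hf.sub (.of_boundedContinuous u)).abs
    refine ⟨a • u, ?_⟩
    have e : (fun ω => |(a • f) ω - (a • u) ω|) = fun ω => |a| * |f ω - u ω| := by
      ext ω
      simp [← mul_sub, abs_mul]
    rw [e, hρ.homog _ _ (abs_nonneg a) hfu]
    have h0 : 0 ≤ rhoOp Eμ Eυ (fun ω => |f ω - u ω|) := by
      rw [← hρ.const 0]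
      exact hρ.mono _ _ (.const 0) hfu fun ω => abs_nonneg _
    rw [lt_div_iff₀ ha] at hu
    nlinarith [abs_nonneg a]

theorem posPart_mem_L1c (hμ : IsSublinearOperator Eμ) (hυ : IsSublinearOperator Eυ)
    {f : Ω → ℝ} (hf : f ∈ L1c Eμ Eυ) : f ⊔ 0 ∈ L1c Eμ Eυ := by
  obtain ⟨hf, hf'⟩ := hf
  have hm : BddMeas (f ⊔ 0) := by
    obtain ⟨hm, C, hC⟩ := hf
    exact ⟨hm.sup measurable_const, C, fun ω =>
      (by simpa using abs_max_sub_max_le_abs (f ω) 0 0 : |max (f ω) 0| ≤ |f ω|).trans (hC ω)⟩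
  refine ⟨hm, fun ε hε => ?_⟩
  obtain ⟨u, hu⟩ := hf' ε hε
  refine ⟨u ⊔ 0, lt_of_le_of_lt ?_ hu⟩
  exact (hμ.rhoOp hυ).mono _ _ (hm.sub (.of_boundedContinuous _)).abs
    (hf.sub (.of_boundedContinuous _)).abs fun ω => abs_max_sub_max_le_abs (f ω) (u ω) 0

/-- Domination at `-f` gives positivity, and `0 ≤ L (f n) ≤ E (f n)` transfers continuity from above
to `L`. -/
theorem IsDominatedLinear.isDaniell {L : (Ω → ℝ) → ℝ} (hμ : IsSublinearOperator Eμ)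
    (hυ : IsSublinearOperator Eυ) (hE : IsSublinearOperator E)
    (hEc : ContinuousFromAboveOnL1c Eμ Eυ E) (hL : IsDominatedLinear Eμ Eυ E L) :
    IsDaniell (L1cSubmodule hμ hυ) L := by
  have hnn : ∀ f ∈ L1cSubmodule hμ hυ, 0 ≤ f → 0 ≤ L f := fun f hf h0 => by
    have hneg : (-1 : ℝ) • f ∈ L1cSubmodule hμ hυ := Submodule.smul_mem _ _ hf
    have h1 : L ((-1 : ℝ) • f) = -1 * L f := hL.smul (-1) f hf
    have h2 := hE.mono _ _ hneg.1 (.const 0) fun ω => by simpa using h0 ω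
    rw [hE.const] at h2
    linarith [hL.le _ hneg]
  refine ⟨boundedContinuous_mem_L1c hμ hυ 1, fun f hf => posPart_mem_L1c hμ hυ hf, hL.add, hL.smul,
    hnn, fun f hf hanti hlim => ?_⟩
  have h1 := hEc f hf (.of_forall hμ hυ fun ω => ⟨fun m n hmn => hanti hmn ω, hlim ω⟩)
  exact squeeze_zero (fun n => hnn _ (hf n) fun ω =>
    Antitone.le_of_tendsto (fun m n hmn => hanti hmn ω) (hlim ω) n) (fun n => hL.le _ (hf n)) h1

end L1c

/-! ### Dominated functionals as probability measures -/

section Integral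

variable {Ω : Type*} [PseudoMetricSpace Ω] [MeasurableSpace Ω] [BorelSpace Ω]
  {E Eμ Eυ : (Ω → ℝ) → ℝ}

/-- An open set is where the truncated distance to its complement is positive. -/
theorem le_generateFrom_superlevel (hμ : IsSublinearOperator Eμ) (hυ : IsSublinearOperator Eυ) :
    ‹MeasurableSpace Ω› ≤ MeasurableSpace.generateFrom
      {s : Set Ω | ∃ f ∈ L1cSubmodule hμ hυ, ∃ t, s = {x | t < f x}} := by
  refine (BorelSpace.measurable_eq (α := Ω)).le.trans ?_
  refine MeasurableSpace.generateFrom_le fun U hU => ?_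
  have hU : IsOpen U := hU
  -- `Metric.infDist` to the empty set is `0`, so the whole space is treated apart.
  rcases Uᶜ.eq_empty_or_nonempty with h | h
  · rw [Set.compl_empty_iff.1 h]
    exact .univ
  refine MeasurableSpace.measurableSet_generateFrom ?_
  let g : Ω →ᵇ ℝ := .ofNormedAddCommGroup (fun x => min (Metric.infDist x Uᶜ) 1)
    ((Metric.continuous_infDist_pt _).min continuous_const) 1 fun x => by
      rw [Real.norm_of_nonneg (le_min Metric.infDist_nonneg zero_le_one)]
      exact min_le_right _ _
  refine ⟨g, boundedContinuous_mem_L1c hμ hυ g, 0, ?_⟩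
  ext x
  have : x ∈ Uᶜ ↔ Metric.infDist x Uᶜ = 0 := hU.isClosed_compl.mem_iff_infDist_zero h
  change x ∈ U ↔ 0 < min (Metric.infDist x Uᶜ) 1
  rw [lt_min_iff, and_iff_left one_pos, Metric.infDist_nonneg.lt_iff_ne', ne_eq, ← this,
    Set.mem_compl_iff, not_not]

/-- Dominated linear functionals are integrals against probability measures. -/
theorem IsDominatedLinear.exists_isIntegralOnL1c {L : (Ω → ℝ) → ℝ} (hμ : IsSublinearOperator Eμ)
    (hυ : IsSublinearOperator Eυ) (hE : IsSublinearOperator E)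
    (hEc : ContinuousFromAboveOnL1c Eμ Eυ E) (hL : IsDominatedLinear Eμ Eυ E L) :
    ∃ P : Measure Ω, IsProbabilityMeasure P ∧ IsIntegralOnL1c Eμ Eυ L P := by
  have hD := hL.isDaniell hμ hυ hE hEc
  obtain ⟨P, hfin, hP⟩ := hD.exists_measure (fun f hf => hf.1.1) (fun f hf => hf.1.2)
    (le_generateFrom_superlevel hμ hυ)
  refine ⟨P, ⟨?_⟩, hP⟩
  -- Domination at `1` and at `-1` bounds `L 1` from both sides.
  have h1 : L 1 = 1 := by
    have h2 : L (fun ω => -1 * (1 : Ω → ℝ) ω) = -1 * L 1 := hL.smul (-1) 1 hD.one_mem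
    have h3 := hL.le _ (Submodule.smul_mem _ (-1 : ℝ) hD.one_mem)
    have h4 := hL.le _ hD.one_mem
    have h5 : E 1 = 1 := hE.const 1
    have h6 : E ((-1 : ℝ) • (1 : Ω → ℝ)) = -1 := by
      convert hE.const (-1) using 2
      ext; simp
    have h7 : L ((-1 : ℝ) • (1 : Ω → ℝ)) = -1 * L 1 := h2
    linarith
  have h2 := hP 1 hD.one_mem
  simp only [h1, Pi.one_apply, integral_const, smul_eq_mul, mul_one] at h2
  exact (ENNReal.toReal_eq_one_iff _).1 h2.symm

end Integral

/-! ### Bounds on tests -/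

section Tests

variable {Ω : Type*} [TopologicalSpace Ω] [MeasurableSpace Ω] {E Eμ Eυ : (Ω → ℝ) → ℝ}

theorem apply_le_one_of_mem_L1cTests (hE : IsSublinearOperator E) (hEρ : ∀ X, E X ≤ rhoOp Eμ Eυ X)
    {f : Ω → ℝ} (hf : f ∈ L1cTests Eμ Eυ) : E f ≤ 1 := by
  rw [← hE.const 1]
  exact hE.mono_quasiSurely hEρ hf.1.1 (.const 1) (hf.2.mono fun _ h => h.2)

theorem apply_nonneg_of_mem_L1cTests (hE : IsSublinearOperator E) (hEρ : ∀ X, E X ≤ rhoOp Eμ Eυ X)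
    {f : Ω → ℝ} (hf : f ∈ L1cTests Eμ Eυ) : 0 ≤ E f := by
  rw [← hE.const 0]
  exact hE.mono_quasiSurely hEρ (.const 0) hf.1.1 (hf.2.mono fun _ h => h.1)

end Tests

/-! ### Sandwich theorem and selection of functionals -/

section Selection

variable {Ω : Type*} [TopologicalSpace Ω] [MeasurableSpace Ω] [OpensMeasurableSpace Ω]
  {E Eμ Eυ : (Ω → ℝ) → ℝ}

/-- A sandwich theorem: if a sublinear operator is at least `β` on a convex set, then so is one of
the linear functionals it dominates. -/
theorem exists_isDominatedLinear_ge (hμ : IsSublinearOperator Eμ) (hυ : IsSublinearOperator Eυ)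
    (hE : IsSublinearOperator E) {S : Set (Ω → ℝ)} (hS : S ⊆ L1c Eμ Eυ) (hconv : Convex ℝ S)
    (hne : S.Nonempty) {β : ℝ} (hβ : ∀ y ∈ S, β ≤ E y) :
    ∃ L, IsDominatedLinear Eμ Eυ E L ∧ ∀ y ∈ S, β ≤ L y := by
  classical
  let V := L1cSubmodule hμ hυ
  let ι := {t : ℝ // 0 ≤ t} × S
  -- A linear functional lies below the infimum `p` of these exactly when it is dominated by `E`
  -- (take `t = 0`) and at least `β` on `S` (take `t = 1`, `x = -y`).
  let r : ι → V → ℝ := fun i x => E (fun ω => (x : Ω → ℝ) ω + i.1 * (i.2 : Ω → ℝ) ω) - i.1 * β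
  let p : V → ℝ := fun x => ⨅ i, r i x
  have hι : Nonempty ι := ⟨⟨⟨0, le_rfl⟩, ⟨hne.some, hne.some_mem⟩⟩⟩
  have hbm : ∀ y ∈ S, BddMeas y := fun y hy => (hS hy).1
  -- Here `β ≤ E` on `S` enters: it keeps the infimum finite.
  have hlow : ∀ (x : V) i, -E (fun ω => -(x : Ω → ℝ) ω) ≤ r i x := by
    rintro x ⟨⟨t, ht⟩, ⟨y, hy⟩⟩
    have h1 := hE.subadd _ _ (x.2.1.add ((hbm y hy).const_mul t)) x.2.1.neg
    simp only [add_neg_cancel_comm, hE.homog t y ht (hbm y hy)] at h1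
    have := mul_le_mul_of_nonneg_left (hβ y hy) ht
    simp only [r]
    linarith
  have hbdd : ∀ x, BddBelow (Set.range fun i => r i x) := fun x =>
    ⟨_, Set.forall_mem_range.2 (hlow x)⟩
  have hple : ∀ x i, p x ≤ r i x := fun x i => ciInf_le (hbdd x) i
  have hadd : ∀ x y, p (x + y) ≤ p x + p y := fun x x' => by
    refine le_ciInf_add_ciInf ?_
    rintro ⟨⟨t, ht⟩, ⟨y, hy⟩⟩ ⟨⟨t', ht'⟩, ⟨y', hy'⟩⟩
    have hsub := hE.subadd _ _ (x.2.1.add ((hbm y hy).const_mul t))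
      (x'.2.1.add ((hbm y' hy').const_mul t'))
    -- The convex weights `t / (t + t')` need a nonzero denominator.
    rcases (add_nonneg ht ht').eq_or_lt with h0 | h0
    · obtain ⟨rfl, rfl⟩ : t = 0 ∧ t' = 0 := ⟨by linarith, by linarith⟩
      refine (hple _ ⟨⟨0, le_rfl⟩, ⟨y, hy⟩⟩).trans ?_
      simpa [r] using hsub
    · have hz := hconv hy hy' (div_nonneg ht h0.le) (div_nonneg ht' h0.le)
        (by rw [← add_div, div_self h0.ne'])
      refine (hple _ ⟨⟨t + t', h0.le⟩, ⟨_, hz⟩⟩).trans ?_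
      have e : (fun ω => ((x + x' : V) : Ω → ℝ) ω +
          (t + t') * ((t / (t + t')) • y + (t' / (t + t')) • y') ω) =
          fun ω => (x : Ω → ℝ) ω + t * y ω + ((x' : Ω → ℝ) ω + t' * y' ω) := by
        ext ω
        simp only [Submodule.coe_add, Pi.add_apply, Pi.smul_apply, smul_eq_mul]
        field_simp
        ring
      simp only [r, e]
      linarith
  have hhom_le : ∀ c : ℝ, 0 < c → ∀ x, p (c • x) ≤ c * p x := fun c hc x => by
    simp only [p]
    rw [Real.mul_iInf_of_nonneg hc.le]
    refine le_ciInf ?_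
    rintro ⟨⟨t, ht⟩, ⟨y, hy⟩⟩
    refine (hple _ ⟨⟨c * t, by positivity⟩, ⟨y, hy⟩⟩).trans (le_of_eq ?_)
    have e : (fun ω => ((c • x : V) : Ω → ℝ) ω + c * t * y ω) =
        fun ω => c * ((x : Ω → ℝ) ω + t * y ω) := by
      ext ω
      simp only [Submodule.coe_smul, Pi.smul_apply, smul_eq_mul]
      ring
    simp only [r, e, hE.homog c _ hc.le (x.2.1.add ((hbm y hy).const_mul t))]
    ring
  have hhom : ∀ c : ℝ, 0 < c → ∀ x, p (c • x) = c * p x := fun c hc x => by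
    refine le_antisymm (hhom_le c hc x) ?_
    have h1 := hhom_le c⁻¹ (inv_pos.2 hc) (c • x)
    rw [smul_smul, inv_mul_cancel₀ hc.ne', one_smul] at h1
    have := mul_le_mul_of_nonneg_left h1 hc.le
    rwa [mul_inv_cancel_left₀ hc.ne'] at this
  -- Extension starts from the zero subspace, where only `0 ≤ p 0` is required.
  obtain ⟨g, -, hg⟩ := exists_extension_of_le_sublinear (⊥ : V →ₗ.[ℝ] ℝ) p hhom hadd <| by
    rintro ⟨x, hx⟩
    obtain rfl : x = 0 := (Submodule.mem_bot ℝ).1 hx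
    have h0 : (⊥ : V →ₗ.[ℝ] ℝ) ⟨0, hx⟩ = 0 := LinearMap.map_zero _
    rw [h0]
    refine le_ciInf fun i => le_trans ?_ (hlow 0 i)
    simp [hE.const]
  have hL : ∀ f (hf : f ∈ V), (if h : f ∈ V then g ⟨f, h⟩ else 0) = g ⟨f, hf⟩ :=
    fun f hf => dif_pos hf
  refine ⟨fun f => if h : f ∈ V then g ⟨f, h⟩ else 0, ⟨fun f hf f' hf' => ?_, fun a f hf => ?_,
    fun f hf => ?_⟩, fun y hy => ?_⟩
  · rw [hL (fun ω => f ω + f' ω) (V.add_mem hf hf'), hL f hf, hL f' hf', ← map_add]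
    rfl
  · rw [hL (fun ω => a * f ω) (V.smul_mem a hf), hL f hf, ← smul_eq_mul, ← map_smul]
    rfl
  · simp only [hL f hf]
    refine (hg _).trans ((hple _ ⟨⟨0, le_rfl⟩, ⟨hne.some, hne.some_mem⟩⟩).trans ?_)
    simp [r]
  · simp only [hL y (hS hy)]
    have h1 := (hg (-⟨y, hS hy⟩)).trans (hple _ ⟨⟨1, zero_le_one⟩, ⟨y, hy⟩⟩)
    simp only [r, map_neg, Submodule.coe_neg, Pi.neg_apply, one_mul, neg_add_cancel,
      hE.const] at h1
    linarith

theorem IsDominatedLinear.conjOp_le {L : (Ω → ℝ) → ℝ} (hμ : IsSublinearOperator Eμ)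
    (hυ : IsSublinearOperator Eυ) (hL : IsDominatedLinear Eμ Eυ E L)
    {f : Ω → ℝ} (hf : f ∈ L1c Eμ Eυ) : conjOp E f ≤ L f := by
  have h1 := hL.smul (-1) f hf
  have h2 := hL.le _ ((L1cSubmodule hμ hυ).smul_mem (-1) hf)
  have e : ((-1 : ℝ) • f) = fun ω => -f ω := by ext; simp
  simp only [neg_one_mul] at h1
  rw [e] at h2
  unfold conjOp
  linarith

theorem convex_L1cTests (hμ : IsSublinearOperator Eμ) (hυ : IsSublinearOperator Eυ) :
    Convex ℝ (L1cTests Eμ Eυ) := by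
  intro f hf g hg a b ha hb hab
  refine ⟨(L1cSubmodule hμ hυ).add_mem ((L1cSubmodule hμ hυ).smul_mem a hf.1)
    ((L1cSubmodule hμ hυ).smul_mem b hg.1), (hf.2.and hμ hυ hg.2).mono ?_⟩
  rintro ω ⟨⟨h1, h2⟩, h3, h4⟩
  simp only [Pi.add_apply, Pi.smul_apply, smul_eq_mul]
  constructor
  · positivity
  · nlinarith

theorem boundedContinuous_mem_L1cTests (hμ : IsSublinearOperator Eμ)
    (hυ : IsSublinearOperator Eυ) (g : Ω →ᵇ ℝ) (hg : ∀ ω, 0 ≤ g ω ∧ g ω ≤ 1) :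
    (g : Ω → ℝ) ∈ L1cTests Eμ Eυ :=
  ⟨boundedContinuous_mem_L1c hμ hυ g, .of_forall hμ hυ hg⟩

theorem convex_levelTests (hμ : IsSublinearOperator Eμ) (hυ : IsSublinearOperator Eυ) (α : ℝ) :
    Convex ℝ (levelTests Eμ Eυ α) := by
  intro f hf g hg a b ha hb hab
  refine ⟨convex_L1cTests hμ hυ hf.1 hg.1 ha hb hab,
    (hμ.apply_combo_le hf.1.1.1 hg.1.1.1 ha hb).trans ?_⟩
  calc a * Eμ f + b * Eμ g ≤ a * α + b * α := by gcongr; exacts [hf.2, hg.2]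
    _ = α := by rw [← add_mul, hab, one_mul]

/-- The sandwich theorem is used on the negatives of the tests, turning the supremum of the
conjugate into a lower bound for `Eυ`. The other inequality is automatic, as a dominated functional
lies above the conjugate. -/
theorem exists_isQSelection (hμ : IsSublinearOperator Eμ) (hυ : IsSublinearOperator Eυ)
    {α : ℝ} (hne : (levelTests Eμ Eυ α).Nonempty) : ∃ L, IsQSelection Eμ Eυ α L := by
  have hconj : ∀ f ∈ levelTests Eμ Eυ α, conjOp Eυ f ≤ 1 := fun f hf =>
    (hυ.neg_le hf.1.1.1).trans (apply_le_one_of_mem_L1cTests hυ (fun X => le_max_right _ _) hf.1)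
  have hbdd : BddAbove (conjOp Eυ '' levelTests Eμ Eυ α) := ⟨1, Set.forall_mem_image.2 hconj⟩
  obtain ⟨L, hL, hge⟩ := exists_isDominatedLinear_ge (S := -levelTests Eμ Eυ α)
    (β := -sSup (conjOp Eυ '' levelTests Eμ Eυ α)) hμ hυ hυ
    (fun f hf => by
      have := (L1cSubmodule hμ hυ).neg_mem (x := -f) hf.1.1
      rwa [neg_neg] at this)
    (convex_levelTests hμ hυ α).neg hne.neg
    (fun f hf => by
      have h1 := le_csSup hbdd ⟨-f, hf, rfl⟩
      simp only [conjOp, Pi.neg_apply, neg_neg] at h1 ⊢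
      change -Eυ f ≤ _ at h1
      linarith)
  refine ⟨L, hL, ?_⟩
  have hle : ∀ f ∈ levelTests Eμ Eυ α, L f ≤ sSup (conjOp Eυ '' levelTests Eμ Eυ α) :=
    fun f hf => by
      have h1 := hge (-f) (by simpa using hf)
      have h2 := hL.smul (-1) f hf.1.1
      have e : (fun ω => -1 * f ω) = -f := by ext; simp
      rw [e] at h2
      linarith
  refine le_antisymm (csSup_le (hne.image _) (Set.forall_mem_image.2 hle))
    (csSup_le (hne.image _) (Set.forall_mem_image.2 fun f hf => ?_))
  exact (hL.conjOp_le hμ hυ hf.1.1).trans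
    (le_csSup ⟨_, Set.forall_mem_image.2 hle⟩ ⟨f, hf, rfl⟩)

theorem convex_powerfulTests (hμ : IsSublinearOperator Eμ) (hυ : IsSublinearOperator Eυ) (α : ℝ)
    (Q : Measure Ω) [IsFiniteMeasure Q] : Convex ℝ (powerfulTests Eμ Eυ α Q) := by
  intro f hf g hg a b ha hb hab
  refine ⟨convex_L1cTests hμ hυ hf.1 hg.1 ha hb hab, ?_⟩
  simp only [Pi.add_apply, Pi.smul_apply, smul_eq_mul]
  rw [integral_add ((hf.1.1.1.integrable Q).const_mul a) ((hg.1.1.1.integrable Q).const_mul b),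
    integral_const_mul, integral_const_mul]
  calc maxPower Eμ Eυ α Q = a * maxPower Eμ Eυ α Q + b * maxPower Eμ Eυ α Q := by
        rw [← add_mul, hab, one_mul]
    _ ≤ _ := by gcongr; exacts [hf.2, hg.2]

theorem exists_isPSelection (hμ : IsSublinearOperator Eμ) (hυ : IsSublinearOperator Eυ)
    {α : ℝ} {Q : Measure Ω} [IsFiniteMeasure Q] (hne : (powerfulTests Eμ Eυ α Q).Nonempty) :
    ∃ M, IsPSelection Eμ Eυ α Q M := by
  have hbdd : BddBelow (Eμ '' powerfulTests Eμ Eυ α Q) := ⟨0, Set.forall_mem_image.2 fun f hf =>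
    apply_nonneg_of_mem_L1cTests hμ (fun X => le_max_left _ _) hf.1⟩
  obtain ⟨M, hM, hge⟩ := exists_isDominatedLinear_ge (S := powerfulTests Eμ Eυ α Q)
    (β := sInf (Eμ '' powerfulTests Eμ Eυ α Q)) hμ hυ hμ (fun f hf => hf.1.1)
    (convex_powerfulTests hμ hυ α Q) hne (fun f hf => csInf_le hbdd ⟨f, hf, rfl⟩)
  refine ⟨M, hM, le_antisymm (le_csInf (hne.image _) (Set.forall_mem_image.2 fun f hf => ?_))
    (le_csInf (hne.image _) (Set.forall_mem_image.2 hge))⟩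
  exact (csInf_le ⟨_, Set.forall_mem_image.2 hge⟩ ⟨f, hf, rfl⟩).trans (hM.le f hf.1.1)

end Selection

/-! ### The classical Neyman–Pearson argument -/

section NeymanPearson

variable {Ω : Type*} [MeasurableSpace Ω] {P Q : Measure Ω}

theorem ae_halfSum_iff {p : Ω → Prop} :
    (∀ᵐ ω ∂(halfSum P Q), p ω) ↔ (∀ᵐ ω ∂P, p ω) ∧ ∀ᵐ ω ∂Q, p ω := by
  rw [halfSum, Measure.ae_ennreal_smul_measure_iff (by simp), ae_add_measure_iff]

instance halfSum.isFiniteMeasure [IsFiniteMeasure P] [IsFiniteMeasure Q] :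
    IsFiniteMeasure (halfSum P Q) :=
  Measure.smul_finite _ (by simp)

theorem absolutelyContinuous_halfSum_left : P ≪ halfSum P Q :=
  Measure.AbsolutelyContinuous.mk fun s _ h => by
    have h1 : ∀ᵐ ω ∂(halfSum P Q), ω ∉ s := measure_eq_zero_iff_ae_notMem.1 h
    exact measure_eq_zero_iff_ae_notMem.2 (ae_halfSum_iff.1 h1).1

theorem absolutelyContinuous_halfSum_right : Q ≪ halfSum P Q :=
  Measure.AbsolutelyContinuous.mk fun s _ h => by
    have h1 : ∀ᵐ ω ∂(halfSum P Q), ω ∉ s := measure_eq_zero_iff_ae_notMem.1 h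
    exact measure_eq_zero_iff_ae_notMem.2 (ae_halfSum_iff.1 h1).2

theorem npForm_of_lt {κ : ℝ} {B : Ω → ℝ} {ω : Ω}
    (h : κ * densityOf P (halfSum P Q) ω < densityOf Q (halfSum P Q) ω) :
    npForm P Q κ B ω = 1 := by
  simp [npForm, h, h.ne']

theorem npForm_of_gt {κ : ℝ} {B : Ω → ℝ} {ω : Ω}
    (h : densityOf Q (halfSum P Q) ω < κ * densityOf P (halfSum P Q) ω) :
    npForm P Q κ B ω = 0 := by
  simp [npForm, h.not_gt, h.ne]

theorem npForm_of_eq {κ : ℝ} {B : Ω → ℝ} {ω : Ω}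
    (h : densityOf Q (halfSum P Q) ω = κ * densityOf P (halfSum P Q) ω) :
    npForm P Q κ B ω = B ω := by
  simp [npForm, h]

/-- The truncation of a function to `[0, 1]` that serves as the randomization. -/
theorem exists_randomization {f : Ω → ℝ} (hf : Measurable f) : ∃ B : Ω → ℝ, Measurable B ∧
    (∀ ω, 0 ≤ B ω ∧ B ω ≤ 1) ∧ ∀ ω, 0 ≤ f ω ∧ f ω ≤ 1 → B ω = f ω :=
  ⟨fun ω => max 0 (min 1 (f ω)), measurable_const.max (measurable_const.min hf),
    fun ω => ⟨le_max_left _ _, max_le zero_le_one (min_le_left _ _)⟩,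
    fun ω h => by
      change max 0 (min 1 (f ω)) = f ω
      rw [min_eq_right h.2, max_eq_right h.1]⟩

/-- A Lagrange multiplier for the two-dimensional problem of Neyman and Pearson. -/
theorem exists_multiplier {C : Set (ℝ × ℝ)} (hC : Convex ℝ C) (h0 : (0, 0) ∈ C) {α γ : ℝ}
    (hα : 0 < α) (h : ∀ z ∈ C, γ ≤ z.2 → α ≤ z.1) :
    ∃ κ : ℝ, 0 ≤ κ ∧ ∀ z ∈ C, κ * α - γ ≤ κ * z.1 - z.2 := by
  -- Separate `C` from the open quadrant of size below `α` and power above `γ`.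
  obtain ⟨u, s, hu1, hu2⟩ := geometric_hahn_banach_open (s := Set.Iio α ×ˢ Set.Ioi γ) (t := C)
    ((convex_Iio α).prod (convex_Ioi γ)) (isOpen_Iio.prod isOpen_Ioi) hC
    (Set.disjoint_left.2 fun z hz hzC => (h z hzC (le_of_lt hz.2)).not_gt hz.1)
  set a := u (1, 0)
  set b := u (0, 1)
  have hu : ∀ x y, u (x, y) = x * a + y * b := fun x y => by
    have e : ((x, y) : ℝ × ℝ) = x • ((1 : ℝ), (0 : ℝ)) + y • ((0 : ℝ), (1 : ℝ)) := by simp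
    rw [e, map_add, map_smul, map_smul, smul_eq_mul, smul_eq_mul]
  have hlt : ∀ δ > 0, ∀ η > 0, (α - δ) * a + (γ + η) * b < s := fun δ hδ η hη => by
    rw [← hu]
    exact hu1 _ ⟨by simpa using hδ, by simpa using hη⟩
  have hle : α * a + γ * b ≤ s := by
    have hc : Continuous fun δ : ℝ => (α - δ) * a + (γ + δ) * b := by fun_prop
    have ht : Tendsto (fun δ : ℝ => (α - δ) * a + (γ + δ) * b) (𝓝[>] 0)
        (𝓝 (α * a + γ * b)) := by
      simpa using (hc.tendsto 0).mono_left nhdsWithin_le_nhds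
    exact le_of_tendsto ht (eventually_mem_nhdsWithin.mono fun δ hδ => (hlt δ hδ δ hδ).le)
  -- The quadrant is unbounded in both directions, which fixes the signs of `a` and `b`.
  have ha : 0 ≤ a := by
    by_contra! ha
    have h1 := hlt ((|s - α * a - (γ + 1) * b| + 1) / (-a)) (by have := neg_pos.2 ha; positivity)
      1 one_pos
    have h2 : (|s - α * a - (γ + 1) * b| + 1) / (-a) * a = -(|s - α * a - (γ + 1) * b| + 1) := by
      rw [div_neg, neg_mul, div_mul_cancel₀ _ ha.ne]
    have h3 := le_abs_self (s - α * a - (γ + 1) * b)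
    rw [sub_mul, h2] at h1
    linarith
  have hb : b ≤ 0 := by
    by_contra! hb
    have h1 := hlt 1 one_pos ((|s - (α - 1) * a - γ * b| + 1) / b) (by positivity)
    have h2 : (|s - (α - 1) * a - γ * b| + 1) / b * b = |s - (α - 1) * a - γ * b| + 1 := by
      field_simp
    have h3 := le_abs_self (s - (α - 1) * a - γ * b)
    rw [add_mul, h2] at h1
    linarith
  have h00 : s ≤ 0 := by simpa [hu] using hu2 _ h0
  -- The separating line is not vertical: if `b = 0`, the quadrant point of size `α / 2` would give
  -- `a * α / 2 < s ≤ 0`.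
  have hb : b < 0 := by
    refine hb.lt_of_ne fun hb0 => ?_
    have h1 := hlt (α / 2) (half_pos hα) 1 one_pos
    rw [hb0] at h1
    nlinarith
  refine ⟨a / (-b), div_nonneg ha (neg_nonneg.2 hb.le), fun z hz => ?_⟩
  have h1 := hle.trans (hu2 z hz)
  rw [show z = (z.1, z.2) from rfl, hu] at h1
  have hb' : 0 < -b := neg_pos.2 hb
  have e : ∀ x y : ℝ, a / (-b) * x - y = (x * a + y * b) / (-b) := fun x y => by
    have hb0 : b ≠ 0 := hb.ne
    field_simp
    ring
  rw [e, e]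
  gcongr

theorem integrable_densityOf_mul {K : Measure Ω} [IsFiniteMeasure Q] {f : Ω → ℝ}
    (hf : BddMeas f) : Integrable (fun ω => densityOf Q K ω * f ω) K :=
  Measure.integrable_toReal_rnDeriv.mul_bdd hf.1.aestronglyMeasurable
    (Eventually.of_forall hf.2.choose_spec)

/-- Continuous functions are dense in `L¹(μ)`, and clamping to `[0, 1]` does not increase the
distance to an indicator. -/
theorem exists_test_approx [TopologicalSpace Ω] [NormalSpace Ω] [BorelSpace Ω]
    (μ : Measure Ω) [IsFiniteMeasure μ] [μ.WeaklyRegular] {S : Set Ω} (hS : MeasurableSet S)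
    {ε : ℝ} (hε : 0 < ε) : ∃ g : Ω →ᵇ ℝ, (∀ ω, 0 ≤ g ω ∧ g ω ≤ 1) ∧
      ∫ ω, |S.indicator (fun _ => 1) ω - g ω| ∂μ ≤ ε := by
  obtain ⟨g, hg, hgi⟩ := ((BddMeas.indicator_one hS).integrable
    μ).exists_boundedContinuous_integral_sub_le hε
  refine ⟨(g ⊔ 0) ⊓ 1, fun ω => ⟨le_min (le_max_right _ _) zero_le_one, min_le_right _ _⟩, ?_⟩
  refine le_trans (integral_mono ?_ ?_ fun ω => ?_) hg
  · exact ((BddMeas.indicator_one hS).sub (.of_boundedContinuous _)).abs.integrable μ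
  · exact ((BddMeas.indicator_one hS).sub (.of_boundedContinuous _)).abs.integrable μ
  · have h1 : ∀ c ∈ Set.Icc (0 : ℝ) 1, |c - min (max (g ω) 0) 1| ≤ |c - g ω| := fun c hc => by
      have e : c = min (max c 0) 1 := by rw [max_eq_left hc.1, min_eq_left hc.2]
      calc |c - min (max (g ω) 0) 1| = |min (max c 0) 1 - min (max (g ω) 0) 1| := by rw [← e]
        _ ≤ |max c 0 - max (g ω) 0| := by simpa using abs_min_sub_min_le_max (max c 0) 1 _ 1
        _ ≤ |c - g ω| := abs_max_sub_max_le_abs _ _ _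
    refine h1 _ ?_
    by_cases h : ω ∈ S <;> simp [h]

/-- Minimizers of the Lagrangian over the continuous tests have the Neyman–Pearson form. -/
theorem exists_npForm_of_le [TopologicalSpace Ω] [NormalSpace Ω] [BorelSpace Ω]
    [IsFiniteMeasure P] [IsFiniteMeasure Q] [(P + Q).WeaklyRegular] {κ : ℝ} (hκ : 0 ≤ κ)
    {f : Ω → ℝ} (hf : BddMeas f) (hf01 : ∀ᵐ ω ∂(halfSum P Q), 0 ≤ f ω ∧ f ω ≤ 1)
    (hmin : ∀ g : Ω →ᵇ ℝ, (∀ ω, 0 ≤ g ω ∧ g ω ≤ 1) →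
      κ * ∫ ω, f ω ∂P - ∫ ω, f ω ∂Q ≤ κ * ∫ ω, g ω ∂P - ∫ ω, g ω ∂Q) :
    ∃ B : Ω → ℝ, Measurable B ∧ (∀ ω, 0 ≤ B ω ∧ B ω ≤ 1) ∧
      ∀ᵐ ω ∂(halfSum P Q), f ω = npForm P Q κ B ω := by
  set G := densityOf P (halfSum P Q) with hG
  set H := densityOf Q (halfSum P Q) with hH
  have hGm : Measurable G := (Measure.measurable_rnDeriv _ _).ennreal_toReal
  have hHm : Measurable H := (Measure.measurable_rnDeriv _ _).ennreal_toReal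
  set S := {ω | κ * G ω < H ω} with hS
  have hSm : MeasurableSet S := measurableSet_lt (hGm.const_mul κ) hHm
  set φ : Ω → ℝ := S.indicator fun _ => 1 with hφ
  have hφb : BddMeas φ := .indicator_one hSm
  -- The indicator `φ` need not lie in `L1c`, so it is reached through continuous tests. An `L¹(P +
  -- Q)` error changes the Lagrangian by at most `κ + 1` times itself.
  have hle : κ * ∫ ω, f ω ∂P - ∫ ω, f ω ∂Q ≤ κ * ∫ ω, φ ω ∂P - ∫ ω, φ ω ∂Q := by
    refine le_of_forall_pos_le_add fun ε hε => ?_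
    obtain ⟨g, hg01, hg⟩ := exists_test_approx (P + Q) hSm (ε := ε / (κ + 1)) (by positivity)
    have hd := (hφb.sub (.of_boundedContinuous g))
    rw [integral_add_measure (hd.abs.integrable P) (hd.abs.integrable Q)] at hg
    have hP0 : 0 ≤ ∫ ω, |φ ω - g ω| ∂P := integral_nonneg fun _ => abs_nonneg _
    have hQ0 : 0 ≤ ∫ ω, |φ ω - g ω| ∂Q := integral_nonneg fun _ => abs_nonneg _
    have h1 := abs_integral_le_integral_abs (f := fun ω => φ ω - g ω) (μ := P)
    have h2 := abs_integral_le_integral_abs (f := fun ω => φ ω - g ω) (μ := Q)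
    rw [integral_sub (hφb.integrable _) ((BddMeas.of_boundedContinuous g).integrable _)] at h1 h2
    have h3 := (abs_le.1 h1).1
    have h4 := (abs_le.1 h2).2
    have h5 := hmin g hg01
    rw [le_div_iff₀ (by positivity)] at hg
    nlinarith
  have hdens : ∀ X, BddMeas X → ∫ ω, X ω ∂P = ∫ ω, G ω * X ω ∂(halfSum P Q) ∧
      ∫ ω, X ω ∂Q = ∫ ω, H ω * X ω ∂(halfSum P Q) := fun X _ =>
    ⟨(integral_toReal_rnDeriv_mul absolutelyContinuous_halfSum_left).symm,
      (integral_toReal_rnDeriv_mul absolutelyContinuous_halfSum_right).symm⟩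
  have hGi : ∀ X, BddMeas X → Integrable (fun ω => G ω * X ω) (halfSum P Q) := fun X hX =>
    integrable_densityOf_mul hX
  have hHi : ∀ X, BddMeas X → Integrable (fun ω => H ω * X ω) (halfSum P Q) := fun X hX =>
    integrable_densityOf_mul hX
  have hdiff := hφb.sub hf
  have e : ∀ ω, (H ω - κ * G ω) * (φ ω - f ω) =
      H ω * (φ ω - f ω) - κ * (G ω * (φ ω - f ω)) := fun ω => by ring
  have hint : Integrable (fun ω => (H ω - κ * G ω) * (φ ω - f ω)) (halfSum P Q) := by
    simp_rw [e]
    exact (hHi _ hdiff).sub ((hGi _ hdiff).const_mul κ)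
  have hval : ∫ ω, (H ω - κ * G ω) * (φ ω - f ω) ∂(halfSum P Q) ≤ 0 := by
    simp_rw [e]
    rw [integral_sub (hHi _ hdiff) ((hGi _ hdiff).const_mul κ), integral_const_mul,
      ← (hdens _ hdiff).1, ← (hdens _ hdiff).2,
      integral_sub (hφb.integrable _) (hf.integrable _),
      integral_sub (hφb.integrable _) (hf.integrable _)]
    linarith
  -- Both factors have the same sign, while the integral is nonpositive; hence the product vanishes
  -- almost everywhere.
  have hnn : 0 ≤ᵐ[halfSum P Q] fun ω => (H ω - κ * G ω) * (φ ω - f ω) := by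
    filter_upwards [hf01] with ω hω
    by_cases h : ω ∈ S
    · have h' : κ * G ω < H ω := h
      simp only [hφ, Set.indicator_of_mem h]
      exact mul_nonneg (by linarith) (by linarith [hω.2])
    · have h' : H ω ≤ κ * G ω := not_lt.1 h
      simp only [hφ, Set.indicator_of_notMem h]
      exact mul_nonneg_of_nonpos_of_nonpos (by linarith) (by linarith [hω.1])
  have hzero := (integral_eq_zero_iff_of_nonneg_ae hnn hint).1
    (le_antisymm hval (integral_nonneg_of_ae hnn))
  obtain ⟨B, hB, hB01, hBf⟩ := exists_randomization hf.1
  refine ⟨B, hB, hB01, ?_⟩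
  filter_upwards [hf01, hzero] with ω hω hz
  rcases lt_trichotomy (κ * G ω) (H ω) with h | h | h
  · rw [npForm_of_lt h]
    have hφ1 : φ ω = 1 := Set.indicator_of_mem (show ω ∈ S from h) _
    rcases mul_eq_zero.1 hz with h' | h' <;> linarith
  · rw [npForm_of_eq h.symm, hBf ω hω]
  · rw [npForm_of_gt h]
    have hφ0 : φ ω = 0 := Set.indicator_of_notMem (show ω ∉ S from h.not_gt) _
    rcases mul_eq_zero.1 hz with h' | h' <;> linarith

/-- A test of full power against `Q` has the Neyman–Pearson form with multiplier `0`. -/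
theorem exists_npForm_zero [IsFiniteMeasure P] [IsFiniteMeasure Q] {f : Ω → ℝ}
    (hf : Measurable f) (h1 : ∀ᵐ ω ∂Q, f ω = 1) :
    ∃ B : Ω → ℝ, Measurable B ∧ (∀ ω, 0 ≤ B ω ∧ B ω ≤ 1) ∧
      ∀ᵐ ω ∂(halfSum P Q), 0 ≤ f ω ∧ f ω ≤ 1 → f ω = npForm P Q 0 B ω := by
  obtain ⟨B, hB, hB01, hBf⟩ := exists_randomization hf
  refine ⟨B, hB, hB01, ?_⟩
  -- Writing `Q` through its density turns `f = 1` `Q`-a.e. into `f = 1` a.e. where the density is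
  -- nonzero.
  have h2 : ∀ᵐ ω ∂((halfSum P Q).withDensity (Q.rnDeriv (halfSum P Q))), f ω = 1 := by
    rwa [Measure.withDensity_rnDeriv_eq _ _ absolutelyContinuous_halfSum_right]
  rw [ae_withDensity_iff (Measure.measurable_rnDeriv _ _)] at h2
  filter_upwards [h2] with ω hω h01
  rcases (ENNReal.toReal_nonneg : 0 ≤ densityOf Q (halfSum P Q) ω).eq_or_lt with h | h
  · rw [npForm_of_eq (by rw [zero_mul]; exact h.symm), hBf ω h01]
  · rw [npForm_of_lt (by rwa [zero_mul])]
    exact hω fun h0 => h.ne' (by simp [h0])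

end NeymanPearson

/-! ### Maximal power against `Q` -/

section Power

variable {Ω : Type*} [TopologicalSpace Ω] [MeasurableSpace Ω]
  {Eμ Eυ L : (Ω → ℝ) → ℝ} {α : ℝ} {Q : Measure Ω}

theorem integral_le_maxPower (hυ : IsSublinearOperator Eυ) (hL : IsDominatedLinear Eμ Eυ Eυ L)
    (hQ : IsIntegralOnL1c Eμ Eυ L Q) {f : Ω → ℝ} (hf : f ∈ levelTests Eμ Eυ α) :
    ∫ ω, f ω ∂Q ≤ maxPower Eμ Eυ α Q := by
  refine le_csSup ⟨1, Set.forall_mem_image.2 fun g hg => ?_⟩ ⟨f, hf, rfl⟩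
  rw [← hQ g hg.1.1]
  exact (hL.le g hg.1.1).trans
    (apply_le_one_of_mem_L1cTests hυ (fun X => le_max_right _ _) hg.1)

/-- The `Q`-power of `f` lies between its conjugate value and the maximal power, and these agree by
the choice of `L` and optimality. -/
theorem IsOptimalTest.integral_eq_maxPower [OpensMeasurableSpace Ω] (hμ : IsSublinearOperator Eμ)
    (hυ : IsSublinearOperator Eυ) (hL : IsQSelection Eμ Eυ α L) (hQ : IsIntegralOnL1c Eμ Eυ L Q)
    {f : Ω → ℝ} (hf : IsOptimalTest Eμ Eυ α f) : ∫ ω, f ω ∂Q = maxPower Eμ Eυ α Q := by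
  refine le_antisymm (integral_le_maxPower hυ hL.1 hQ hf.1) ?_
  have e : (fun f : Ω → ℝ => ∫ ω, f ω ∂Q) '' levelTests Eμ Eυ α = L '' levelTests Eμ Eυ α :=
    Set.image_congr fun g hg => (hQ g hg.1.1).symm
  rw [maxPower, e, hL.2, ← hf.2, ← hQ f hf.1.1.1]
  exact hL.1.conjOp_le hμ hυ hf.1.1.1

/-- If a test of level below `α` is most powerful against `Q`, then the maximal power is `1`. -/
theorem one_le_maxPower [OpensMeasurableSpace Ω] (hμ : IsSublinearOperator Eμ)
    (hυ : IsSublinearOperator Eυ)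
    (hα1 : α < 1) [IsProbabilityMeasure Q] (hL : IsDominatedLinear Eμ Eυ Eυ L)
    (hQ : IsIntegralOnL1c Eμ Eυ L Q) {X : Ω → ℝ} (hX : X ∈ levelTests Eμ Eυ α) (hXα : Eμ X < α)
    (hXQ : ∫ ω, X ω ∂Q = maxPower Eμ Eυ α Q) : 1 ≤ maxPower Eμ Eυ α Q := by
  -- This `ε` solves `(1 - ε) * Eμ X + ε = α`, so the mixture of `X` with `1` uses up the level.
  set ε := (α - Eμ X) / (1 - Eμ X) with hε
  have h1 : 0 < 1 - Eμ X := by linarith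
  have hε0 : 0 < ε := div_pos (by linarith) h1
  have hε1 : ε ≤ 1 := (div_le_one h1).2 (by linarith)
  have hone : (1 : Ω → ℝ) ∈ L1cTests Eμ Eυ :=
    boundedContinuous_mem_L1cTests hμ hυ 1 fun ω => by simp
  have hmem : (1 - ε) • X + ε • 1 ∈ levelTests Eμ Eυ α := by
    refine ⟨convex_L1cTests hμ hυ hX.1 hone (by linarith) hε0.le (by ring), ?_⟩
    refine (hμ.apply_combo_le hX.1.1.1 hone.1.1 (by linarith) hε0.le).trans (le_of_eq ?_)
    have h2 : Eμ 1 = 1 := hμ.const 1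
    have h3 : ε * (1 - Eμ X) = α - Eμ X := div_mul_cancel₀ _ h1.ne'
    rw [h2]
    linarith
  have h2 := integral_le_maxPower hυ hL hQ hmem
  simp only [Pi.add_apply, Pi.smul_apply, Pi.one_apply, smul_eq_mul, mul_one] at h2
  rw [integral_add ((hX.1.1.1.integrable Q).const_mul _) (integrable_const ε),
    integral_const_mul, hXQ] at h2
  simp only [integral_const, probReal_univ, one_smul] at h2
  nlinarith

end Power

/-! ### The two cases of the theorem -/

theorem mainTheorem7 {Ω : Type*} [MetricSpace Ω] [CompleteSpace Ω]
    [TopologicalSpace.SeparableSpace Ω] [MeasurableSpace Ω] [BorelSpace Ω]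
    (Eμ Eυ : (Ω → ℝ) → ℝ) (hμ : IsSublinearOperator Eμ) (hυ : IsSublinearOperator Eυ)
    (hμc : ContinuousFromAboveOnL1c Eμ Eυ Eμ) (hυc : ContinuousFromAboveOnL1c Eμ Eυ Eυ)
    (α : ℝ) (hα0 : 0 < α) (hα1 : α < 1) (hex : ∃ f, IsOptimalTest Eμ Eυ α f) :
    (∃ L, IsQSelection Eμ Eυ α L) ∧
    ∀ L, IsQSelection Eμ Eυ α L →
      ∃ Q : Measure Ω, IsProbabilityMeasure Q ∧ IsIntegralOnL1c Eμ Eυ L Q ∧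
        -- every optimal test is most powerful against `Q`
        (∀ f, IsOptimalTest Eμ Eυ α f → ∫ ω, f ω ∂Q = maxPower Eμ Eυ α Q) ∧
        -- first case: no test of level below `α` attains the maximal `Q`-power
        ((∀ X ∈ levelTests Eμ Eυ α, Eμ X < α → ∫ ω, X ω ∂Q < maxPower Eμ Eυ α Q) →
          (∃ M, IsPSelection Eμ Eυ α Q M) ∧
          ∀ M, IsPSelection Eμ Eυ α Q M →
            ∃ P : Measure Ω, IsProbabilityMeasure P ∧ IsIntegralOnL1c Eμ Eυ M P ∧
              ∃ κ : ℝ, 0 ≤ κ ∧ ∀ f, IsOptimalTest Eμ Eυ α f →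
                ∃ B : Ω → ℝ, Measurable B ∧ (∀ ω, 0 ≤ B ω ∧ B ω ≤ 1) ∧
                  ∀ᵐ ω ∂(halfSum P Q), f ω = npForm P Q κ B ω) ∧
        -- second case: some test of level below `α` attains the maximal `Q`-power
        ((∃ X ∈ levelTests Eμ Eυ α, Eμ X < α ∧ ∫ ω, X ω ∂Q = maxPower Eμ Eυ α Q) →
          ∀ P : Measure Ω, IsProbabilityMeasure P → ∀ f, IsOptimalTest Eμ Eυ α f →
            ∃ B : Ω → ℝ, Measurable B ∧ (∀ ω, 0 ≤ B ω ∧ B ω ≤ 1) ∧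
              -- `0 ≤ f ≤ 1` only holds outside a polar set, which an arbitrary `P` may charge
              ∀ᵐ ω ∂(halfSum P Q), (0 ≤ f ω ∧ f ω ≤ 1) → f ω = npForm P Q 0 B ω) := by
  obtain ⟨f₀, hf₀⟩ := hex
  refine ⟨exists_isQSelection hμ hυ ⟨f₀, hf₀.1⟩, fun L hL => ?_⟩
  obtain ⟨Q, hQp, hQ⟩ := hL.1.exists_isIntegralOnL1c hμ hυ hυ hυc
  have hpow : ∀ f, IsOptimalTest Eμ Eυ α f → ∫ ω, f ω ∂Q = maxPower Eμ Eυ α Q := fun f hf =>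
    hf.integral_eq_maxPower hμ hυ hL hQ
  have hQae : ∀ f ∈ L1cTests Eμ Eυ, ∀ᵐ ω ∂Q, 0 ≤ f ω ∧ f ω ≤ 1 := fun f hf =>
    hQ.ae_of_quasiSurely (fun X => le_max_right _ _) hL.1 hf.2
  refine ⟨Q, hQp, hQ, hpow, fun hcase => ?_, ?_⟩
  · have hmem : ∀ f, IsOptimalTest Eμ Eυ α f → f ∈ powerfulTests Eμ Eυ α Q := fun f hf =>
      ⟨hf.1.1, (hpow f hf).ge⟩
    have hα : ∀ Y ∈ powerfulTests Eμ Eυ α Q, α ≤ Eμ Y := fun Y hY => by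
      by_contra! h
      exact (hcase Y ⟨hY.1, h.le⟩ h).not_ge hY.2
    refine ⟨exists_isPSelection hμ hυ ⟨f₀, hmem f₀ hf₀⟩, fun M hM => ?_⟩
    obtain ⟨P, hPp, hP⟩ := hM.1.exists_isIntegralOnL1c hμ hυ hμ hμc
    have hPae : ∀ f ∈ L1cTests Eμ Eυ, ∀ᵐ ω ∂P, 0 ≤ f ω ∧ f ω ≤ 1 := fun f hf =>
      hP.ae_of_quasiSurely (fun X => le_max_left _ _) hM.1 hf.2
    -- The equality of infima carries the bound `α` from `Eμ` to `P`.
    have hPα : ∀ Y ∈ powerfulTests Eμ Eυ α Q, α ≤ ∫ ω, Y ω ∂P := fun Y hY => by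
      have hne : (powerfulTests Eμ Eυ α Q).Nonempty := ⟨Y, hY⟩
      have hbdd : BddBelow (M '' powerfulTests Eμ Eυ α Q) :=
        ⟨0, Set.forall_mem_image.2 fun Z hZ => by
          rw [hP Z hZ.1.1]
          exact integral_nonneg_of_ae ((hPae Z hZ.1).mono fun ω h => h.1)⟩
      rw [← hP Y hY.1.1]
      refine le_trans ?_ (csInf_le hbdd ⟨Y, hY, rfl⟩)
      rw [hM.2]
      exact le_csInf (hne.image _) (Set.forall_mem_image.2 hα)
    -- The multiplier comes from the set of all tests, before any optimal test is fixed.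
    obtain ⟨κ, hκ, hmult⟩ := exists_multiplier
      (C := (fun f : Ω → ℝ => (∫ ω, f ω ∂P, ∫ ω, f ω ∂Q)) '' L1cTests Eμ Eυ)
      (α := α) (γ := maxPower Eμ Eυ α Q)
      (by
        rintro _ ⟨f, hf, rfl⟩ _ ⟨g, hg, rfl⟩ a b ha hb hab
        refine ⟨_, convex_L1cTests hμ hυ hf hg ha hb hab, ?_⟩
        simp only [Pi.add_apply, Pi.smul_apply, smul_eq_mul, Prod.smul_mk, Prod.mk_add_mk]
        rw [integral_add ((hf.1.1.integrable P).const_mul a) ((hg.1.1.integrable P).const_mul b),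
          integral_add ((hf.1.1.integrable Q).const_mul a) ((hg.1.1.integrable Q).const_mul b)]
        simp only [integral_const_mul])
      ⟨0, boundedContinuous_mem_L1cTests hμ hυ 0 (by simp), by simp⟩ hα0
      (by
        rintro _ ⟨f, hf, rfl⟩ h
        exact hPα f ⟨hf, h⟩)
    refine ⟨P, hPp, hP, κ, hκ, fun f hf => ?_⟩
    refine exists_npForm_of_le hκ hf.1.1.1.1
      (ae_halfSum_iff.2 ⟨hPae f hf.1.1, hQae f hf.1.1⟩) fun g hg => ?_
    have h1 := hmult _ ⟨g, boundedContinuous_mem_L1cTests hμ hυ g hg, rfl⟩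
    have h2 : ∫ ω, f ω ∂P ≤ α := by
      rw [← hP f hf.1.1.1]
      exact (hM.1.le f hf.1.1.1).trans hf.1.2
    rw [hpow f hf]
    exact (sub_le_sub_right (mul_le_mul_of_nonneg_left h2 hκ) _).trans h1
  · rintro ⟨X, hX, hXα, hXQ⟩ P hPp f hf
    refine exists_npForm_zero hf.1.1.1.1.1 ?_
    have h1 := one_le_maxPower hμ hυ hα1 hL.1 hQ hX hXα hXQ
    rw [← hpow f hf] at h1
    have hfi : Integrable f Q := hf.1.1.1.1.integrable Q
    have hnn : 0 ≤ᵐ[Q] fun ω => 1 - f ω := (hQae f hf.1.1).mono fun ω h => sub_nonneg.2 h.2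
    have hint : Integrable (fun ω => 1 - f ω) Q := (integrable_const 1).sub hfi
    have h0 : ∫ ω, (1 - f ω) ∂Q = 0 := by
      refine le_antisymm ?_ (integral_nonneg_of_ae hnn)
      rw [integral_sub (integrable_const 1) hfi]
      simpa using h1
    filter_upwards [(integral_eq_zero_iff_of_nonneg_ae hnn hint).1 h0] with ω hω
    have : 1 - f ω = 0 := hω
    linarith
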